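/- A \emph{bipartite graph} $\Gamma=(V_1,E,V_2)$ consists of a finite set $E$ of edges and finite sets $V_1$ of left and $V_2$ of right vertices, every edge $e$ joining a vertex $V_1(e)\in V_1$ to a vertex $V_2(e)\in V_2$; multiple edges are allowed and there are no isolated vertices. Its degree is $|\Gamma|=|E|$. Isomorphisms preserve the two sides, and $\mathrm{Aut}(\Gamma)$ is regarded as a group of permutations of $E$. Let $B_n$ be the complex vector space whose basis is the finite set of isomorphism classes of bipartite graphs of degree $n\ge 0$, and let $B_\infty=\bigoplus_{n\ge0}B_n$. \emph{Product on $B_n$.} Let $\Gamma=(V_1,E,V_2)$ and $\Gamma'=(V_1',E',V_2')$ have degree $n$. A \emph{gluing} is a pair $(\chi,F)$ of a valency-preserving map $\chi:V_2\to V_1'$ and a subset $F\subset E\times E'$ that projects bijectively onto $E$ and onto $E'$ and satisfies $\chi(V_2(e))=V_1'(e')$ for all $(e,e')\in F$. It gives the bipartite graph $(V_1,\overline F,V_2')$ whose edges are the pairs $(e,e')\in F$, joining $V_1(e)$ to $V_2'(e')$. Let $\mathrm{Aut}_F(V_1,\overline F,V_2')$ be the subgroup of those automorphisms of this graph that induce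 on $E$ an automorphism of $\Gamma$. Two gluings are equivalent if they are carried to each other by an element of $\mathrm{Aut}(\Gamma)\times\mathrm{Aut}(\Gamma')$. The bilinear product $*$ on $B_n$ is given by $$[\Gamma]*[\Gamma']=\sum_{(\chi,F)}\frac{|\mathrm{Aut}(V_1,\overline F,V_2')|}{|\mathrm{Aut}_F(V_1,\overline F,V_2')|}\,[(V_1,\overline F,V_2')],$$ the sum being over the equivalence classes of gluings. \emph{Extension.} A bipartite graph is \emph{simple} if each of its connected components has exactly two vertices. A \emph{standard extension} of degree $n$ of a graph $\Gamma$ of degree $m\le n$ is a disjoint union $\tilde\Gamma=\Gamma\sqcup S$ with $S=\tilde\Gamma\setminus\Gamma$ a simple graph of degree $n-m$. The linear map $\rho_n:B_m\to B_n$ is given by $$\rho_n(\Gamma)=\sum_{\tilde\Gamma}\frac{|\mathrm{Aut}(\tilde\Gamma)|}{|\mathrm{Aut}(\Gamma)|\,|\mathrm{Aut}(\tilde\Gamma\setminus\Gamma)|}\,\tilde\Gamma ,$$ the sum being over the isomorphism classes of standard extensions of degree $n$. \emph{Product on $B_\infty$.} For graphs $\Gamma_1,\Gamma_2$ and $n\ge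 M:=\max\{|\Gamma_1|,|\Gamma_2|\}$ define $\{\Gamma_1\Gamma_2\}_n\in B_n$ recursively by $$\{\Gamma_1\Gamma_2\}_n=\rho_n(\Gamma_1)*\rho_n(\Gamma_2)-\sum_{k=M}^{n-1}\rho_n(\{\Gamma_1\Gamma_2\}_k)$$ (for $n=M$ the sum is empty), and let $\circ$ be the bilinear product on $B_\infty$ with $\Gamma_1\circ\Gamma_2=\sum_{n\ge M}\{\Gamma_1\Gamma_2\}_n$. \textbf{Lemma.} For all bipartite graphs $\Gamma_1,\Gamma_2$ one has $\{\Gamma_1\Gamma_2\}_n=0$ for $n>|\Gamma_1|+|\Gamma_2|$ (so the sum defining $\Gamma_1\circ\Gamma_2$ is finite), and the product $\circ$ on $B_\infty$ is associative. -/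

import Mathlib

open Finset

noncomputable section

namespace BipartiteGraphs

/-- A bipartite multigraph `(V₁, E, V₂)` with edge set `E` and without isolated vertices: two
edges are related by `left` (by `right`) iff they share their vertex in `V₁` (in `V₂`). As every
vertex is the end of an edge, the vertex sets are the quotients `V₁` and `V₂` below. -/
structure BipGraph (E : Type) where
  left : Setoid E
  right : Setoid E

namespace BipGraph

variable {E E' D D' : Type}

/-- The set of left vertices. -/
abbrev V₁ (Γ : BipGraph E) : Type := Quotient Γ.left

/-- The set of right vertices. -/
abbrev V₂ (Γ : BipGraph E) : Type := Quotient Γ.right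

/-- The left vertex of an edge. -/
def end₁ (Γ : BipGraph E) (e : E) : Γ.V₁ := Quotient.mk Γ.left e

/-- The right vertex of an edge. -/
def end₂ (Γ : BipGraph E) (e : E) : Γ.V₂ := Quotient.mk Γ.right e

/-- The valency of a left vertex. -/
def valency₁ (Γ : BipGraph E) (v : Γ.V₁) : ℕ := Nat.card {e : E // Γ.end₁ e = v}

/-- The valency of a right vertex. -/
def valency₂ (Γ : BipGraph E) (v : Γ.V₂) : ℕ := Nat.card {e : E // Γ.end₂ e = v}

/-- A bijection between the edge sets is (the edge part of) an isomorphism of bipartite graphs: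
it respects the relations of having a common left or a common right vertex. The bijections of
the vertex sets are determined by it. -/
def IsIso (Γ : BipGraph E) (Δ : BipGraph D) (a : E ≃ D) : Prop :=
  ∀ e f, (Γ.end₁ e = Γ.end₁ f ↔ Δ.end₁ (a e) = Δ.end₁ (a f)) ∧
    (Γ.end₂ e = Γ.end₂ f ↔ Δ.end₂ (a e) = Δ.end₂ (a f))

/-- The order of the automorphism group of a bipartite graph. -/
def autCard (Γ : BipGraph E) : ℕ := Nat.card {a : E ≃ E // Γ.IsIso Γ a}

theorem IsIso.refl (Γ : BipGraph E) : Γ.IsIso Γ (Equiv.refl E) := fun _ _ => by simp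

theorem IsIso.symm {Γ : BipGraph E} {Δ : BipGraph D} {a : E ≃ D} (h : Γ.IsIso Δ a) :
    Δ.IsIso Γ a.symm := fun e f => by
  have := h (a.symm e) (a.symm f)
  simp only [Equiv.apply_symm_apply] at this
  exact ⟨this.1.symm, this.2.symm⟩

theorem IsIso.trans {Γ : BipGraph E} {Δ : BipGraph D} {Θ : BipGraph D'} {a : E ≃ D}
    {b : D ≃ D'} (h : Γ.IsIso Δ a) (h' : Δ.IsIso Θ b) : Γ.IsIso Θ (a.trans b) :=
  fun e f => ⟨(h e f).1.trans (h' _ _).1, (h e f).2.trans (h' _ _).2⟩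

theorem autCard_congr {Γ : BipGraph E} {Δ : BipGraph D} {a : E ≃ D} (h : Γ.IsIso Δ a) :
    Γ.autCard = Δ.autCard := by
  refine Nat.card_congr
    { toFun := fun u => ⟨(a.symm.trans u.1).trans a, (h.symm.trans u.2).trans h⟩
      invFun := fun u => ⟨(a.trans u.1).trans a.symm, (h.trans u.2).trans h.symm⟩
      left_inv := fun u => ?_
      right_inv := fun u => ?_ } <;>
  · apply Subtype.ext; ext; simp

/-- A graph is simple if all its connected components have exactly two vertices: any two edges
in one connected component (a class of the join of the two relations) have the same ends. -/
def IsSimple (Γ : BipGraph E) : Prop :=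
  ∀ e f, (Γ.left ⊔ Γ.right) e f → Γ.end₁ e = Γ.end₁ f ∧ Γ.end₂ e = Γ.end₂ f

/-- The disjoint union of two bipartite graphs. -/
def disjUnion (Γ : BipGraph E) (Δ : BipGraph D) : BipGraph (E ⊕ D) where
  left := Setoid.ker (Sum.map Γ.end₁ Δ.end₁)
  right := Setoid.ker (Sum.map Γ.end₂ Δ.end₂)

/-- Renaming the edges along a bijection. -/
def relabel (Γ : BipGraph E) (a : E ≃ D) : BipGraph D where
  left := Γ.left.comap a.symm
  right := Γ.right.comap a.symm

@[simp] theorem end₁_eq (Γ : BipGraph E) {e f : E} : Γ.end₁ e = Γ.end₁ f ↔ Γ.left e f :=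
  Quotient.eq

@[simp] theorem end₂_eq (Γ : BipGraph E) {e f : E} : Γ.end₂ e = Γ.end₂ f ↔ Γ.right e f :=
  Quotient.eq

theorem relabel_isIso (Γ : BipGraph E) (a : E ≃ D) : Γ.IsIso (Γ.relabel a) a :=
  fun e f => by simp [relabel, Setoid.comap_rel]

theorem disjUnion_isIso {Γ : BipGraph E} {Δ : BipGraph D} {Γ' : BipGraph E'} {Δ' : BipGraph D'}
    {a : E ≃ E'} {b : D ≃ D'} (h : Γ.IsIso Γ' a) (h' : Δ.IsIso Δ' b) :
    (Γ.disjUnion Δ).IsIso (Γ'.disjUnion Δ') (a.sumCongr b) := by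
  rintro (e | e) (f | f) <;>
  simp only [end₁_eq, end₂_eq, disjUnion, Setoid.ker_def, Sum.map_inl, Sum.map_inr,
    Equiv.sumCongr_apply, Sum.inl.injEq, Sum.inr.injEq, reduceCtorEq, iff_self, and_self]
  · simpa using h e f
  · simpa using h' e f

theorem IsSimple.of_iso {Γ : BipGraph E} {Δ : BipGraph D} {a : E ≃ D} (h : Γ.IsIso Δ a)
    (hs : Γ.IsSimple) : Δ.IsSimple := by
  have key : Δ.left ⊔ Δ.right ≤ (Γ.left ⊔ Γ.right).comap a.symm := by
    refine sup_le ?_ ?_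
    · intro e f hef
      exact (le_sup_left : Γ.left ≤ Γ.left ⊔ Γ.right)
        (Γ.end₁_eq.1 ((h.symm e f).1.1 (Δ.end₁_eq.2 hef)))
    · intro e f hef
      exact (le_sup_right : Γ.right ≤ Γ.left ⊔ Γ.right)
        (Γ.end₂_eq.1 ((h.symm e f).2.1 (Δ.end₂_eq.2 hef)))
  intro e f hef
  have := hs _ _ (key hef)
  exact ⟨(h.symm e f).1.2 this.1, (h.symm e f).2.2 this.2⟩

/-- A way of gluing `(V₁, E, V₂)` to `(V₁', E', V₂')`: a map `χ : V₂ → V₁'` that preserves the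
valencies, and a subset of `E × E'` that projects bijectively onto `E` and onto `E'` (that is, the
graph of a bijection `F`) and is consistent with `χ`. -/
structure Gluing (Γ : BipGraph E) (Γ' : BipGraph E') where
  χ : Γ.V₂ → Γ'.V₁
  valency_eq : ∀ v, Γ'.valency₁ (χ v) = Γ.valency₂ v
  F : E ≃ E'
  consistent : ∀ e, χ (Γ.end₂ e) = Γ'.end₁ (F e)

namespace Gluing

variable {Γ : BipGraph E} {Γ' : BipGraph E'} {Δ : BipGraph D} {Δ' : BipGraph D'}

/-- The glued graph `(V₁, F, V₂')`; the edge `(e, F e)` is denoted by `e`. -/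
def glued (G : Gluing Γ Γ') : BipGraph E where
  left := Γ.left
  right := Γ'.right.comap G.F

/-- The order of the group of those automorphisms of the glued graph that induce on `E` an
automorphism of `(V₁, E, V₂)`. -/
def autCard (G : Gluing Γ Γ') : ℕ :=
  Nat.card {a : E ≃ E // G.glued.IsIso G.glued a ∧ Γ.IsIso Γ a}

/-- Two gluings are equivalent if automorphisms of the two graphs carry one to the other.
(The map `χ` of a gluing is determined by `F`, so that it need not be mentioned.) -/
def Equivalent (G H : Gluing Γ Γ') : Prop :=
  ∃ a : E ≃ E, ∃ b : E' ≃ E', Γ.IsIso Γ a ∧ Γ'.IsIso Γ' b ∧ ∀ e, H.F (a e) = b (G.F e)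

instance setoid (Γ : BipGraph E) (Γ' : BipGraph E') : Setoid (Gluing Γ Γ') where
  r := Equivalent
  iseqv :=
    { refl := fun _ => ⟨.refl _, .refl _, .refl _, .refl _, fun _ => rfl⟩
      symm := by
        rintro G H ⟨a, b, ha, hb, h⟩
        refine ⟨a.symm, b.symm, ha.symm, hb.symm, fun e => ?_⟩
        rw [Equiv.eq_symm_apply, ← h, Equiv.apply_symm_apply]
      trans := by
        rintro G H K ⟨a, b, ha, hb, h⟩ ⟨a', b', ha', hb', h'⟩
        exact ⟨a.trans a', b.trans b', ha.trans ha', hb.trans hb', fun e => by simp [h, h']⟩ }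

theorem F_injective : Function.Injective (F : Gluing Γ Γ' → (E ≃ E')) := by
  rintro ⟨χ, _, F, h⟩ ⟨χ', _, F', h'⟩ (rfl : F = F')
  have : χ = χ' := by
    funext v
    induction v using Quotient.inductionOn with
    | h e => exact (h e).trans (h' e).symm
  subst this
  rfl

instance [Finite E] [Finite E'] : Finite (Gluing Γ Γ') := Finite.of_injective _ F_injective

theorem end_iff (G : Gluing Γ Γ') [Finite E] (e f : E) :
    Γ.end₂ e = Γ.end₂ f ↔ Γ'.end₁ (G.F e) = Γ'.end₁ (G.F f) := by
  refine ⟨fun h => by rw [← G.consistent, ← G.consistent, h], fun h => ?_⟩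
  have : Finite E' := Finite.of_equiv _ G.F
  let g : {x : E // Γ.end₂ x = Γ.end₂ e} → {y : E' // Γ'.end₁ y = G.χ (Γ.end₂ e)} :=
    fun x => ⟨G.F x.1, by rw [← G.consistent, x.2]⟩
  have hg : Function.Injective g := fun x y hxy =>
    Subtype.ext (G.F.injective (congrArg Subtype.val hxy))
  have hb : Function.Bijective g :=
    (Nat.bijective_iff_injective_and_card g).2 ⟨hg, (G.valency_eq (Γ.end₂ e)).symm⟩
  obtain ⟨x, hx⟩ := hb.2 ⟨G.F f, by rw [← h, G.consistent]⟩
  have hxf : x.1 = f := G.F.injective (congrArg Subtype.val hx)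
  rw [← hxf, x.2]

/-- The gluing given by a bijection of the edges. -/
def ofEquiv (F : E ≃ E') (h : ∀ e f, Γ.end₂ e = Γ.end₂ f ↔ Γ'.end₁ (F e) = Γ'.end₁ (F f)) :
    Gluing Γ Γ' where
  χ := Quotient.lift (fun e => Γ'.end₁ (F e)) fun e f hef => (h e f).1 (Quotient.sound hef)
  valency_eq := by
    intro v
    induction v using Quotient.inductionOn with
    | h e =>
      refine Nat.card_congr (F.subtypeEquiv fun f => ?_).symm
      exact h f e
  F := F
  consistent := fun _ => rfl

/-- Transport of a gluing along isomorphisms. -/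
def map [Finite E] {a : E ≃ D} {b : E' ≃ D'} (ha : Γ.IsIso Δ a) (hb : Γ'.IsIso Δ' b)
    (G : Gluing Γ Γ') : Gluing Δ Δ' :=
  ofEquiv ((a.symm.trans G.F).trans b) fun e f =>
    ((ha.symm e f).2.trans (G.end_iff _ _)).trans (hb _ _).1

theorem map_glued_isIso [Finite E] {a : E ≃ D} {b : E' ≃ D'} (ha : Γ.IsIso Δ a)
    (hb : Γ'.IsIso Δ' b) (G : Gluing Γ Γ') : G.glued.IsIso (G.map ha hb).glued a := by
  intro e f
  have h1 := (ha e f).1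
  have h2 := (hb (G.F e) (G.F f)).2
  simp only [end₁_eq, end₂_eq] at h1 h2
  simp [glued, map, ofEquiv, Setoid.comap_rel, h1, h2]

theorem map_autCard [Finite E] {a : E ≃ D} {b : E' ≃ D'} (ha : Γ.IsIso Δ a)
    (hb : Γ'.IsIso Δ' b) (G : Gluing Γ Γ') : (G.map ha hb).autCard = G.autCard := by
  have hg := G.map_glued_isIso ha hb
  refine Nat.card_congr
    { toFun := fun u => ⟨(a.trans u.1).trans a.symm,
        (hg.trans u.2.1).trans hg.symm, (ha.trans u.2.2).trans ha.symm⟩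
      invFun := fun u => ⟨(a.symm.trans u.1).trans a,
        (hg.symm.trans u.2.1).trans hg, (ha.symm.trans u.2.2).trans ha⟩
      left_inv := fun u => ?_
      right_inv := fun u => ?_ } <;>
  · apply Subtype.ext; ext; simp

theorem equivalent_iff_map [Finite E] {G H : Gluing Γ Γ'} :
    G ≈ H ↔ ∃ a : E ≃ E, ∃ b : E' ≃ E', ∃ ha : Γ.IsIso Γ a, ∃ hb : Γ'.IsIso Γ' b,
      H = G.map ha hb := by
  constructor
  · rintro ⟨a, b, ha, hb, h⟩
    refine ⟨a, b, ha, hb, F_injective (Equiv.ext fun e => ?_)⟩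
    simpa [map, ofEquiv] using h (a.symm e)
  · rintro ⟨a, b, ha, hb, rfl⟩
    exact ⟨a, b, ha, hb, fun e => by simp [map, ofEquiv]⟩

/-- Transport of equivalence classes of gluings along isomorphisms. -/
def mapQuotient [Finite E] [Finite D] {a : E ≃ D} {b : E' ≃ D'} (ha : Γ.IsIso Δ a)
    (hb : Γ'.IsIso Δ' b) : Quotient (setoid Γ Γ') ≃ Quotient (setoid Δ Δ') :=
  Quotient.congr
    { toFun := map ha hb
      invFun := map ha.symm hb.symm
      left_inv := fun G => F_injective (Equiv.ext fun e => by simp [map, ofEquiv])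
      right_inv := fun G => F_injective (Equiv.ext fun e => by simp [map, ofEquiv]) }
    (by
      intro G H
      constructor
      · rintro ⟨u, v, hu, hv, h⟩
        exact ⟨(a.symm.trans u).trans a, (b.symm.trans v).trans b, (ha.symm.trans hu).trans ha,
          (hb.symm.trans hv).trans hb, fun e => by simp [map, ofEquiv, h]⟩
      · rintro ⟨u, v, hu, hv, h⟩
        refine ⟨(a.trans u).trans a.symm, (b.trans v).trans b.symm, (ha.trans hu).trans ha.symm,
          (hb.trans hv).trans hb.symm, fun e => ?_⟩
        have := h (a e)
        simp only [map, ofEquiv, Equiv.coe_fn_mk, Equiv.trans_apply,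
          Equiv.symm_apply_apply] at this
        simp [← this])

end Gluing

instance isoSetoid (n : ℕ) : Setoid (BipGraph (Fin n)) where
  r Γ Δ := ∃ a, Γ.IsIso Δ a
  iseqv :=
    { refl := fun Γ => ⟨_, IsIso.refl Γ⟩
      symm := fun ⟨_, h⟩ => ⟨_, h.symm⟩
      trans := fun ⟨_, h⟩ ⟨_, h'⟩ => ⟨_, h.trans h'⟩ }

instance [Finite E] : Finite (BipGraph E) := by
  have h : Function.Injective
      (fun Γ : BipGraph E => ((fun e f => Γ.left e f, fun e f => Γ.right e f) :
        (E → E → Prop) × (E → E → Prop))) := by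
    rintro ⟨l, r⟩ ⟨l', r'⟩ h
    simp only [Prod.mk.injEq] at h
    obtain rfl : l = l' := Setoid.ext fun e f => iff_of_eq (congrFun (congrFun h.1 e) f)
    obtain rfl : r = r' := Setoid.ext fun e f => iff_of_eq (congrFun (congrFun h.2 e) f)
    rfl
  exact Finite.of_injective _ h

end BipGraph

open BipGraph

/-- The set of isomorphism classes of bipartite graphs of degree `n`, i.e. with `n` edges. -/
def BipClass (n : ℕ) : Type := Quotient (BipGraph.isoSetoid n)

instance (n : ℕ) : Finite (BipClass n) := inferInstanceAs (Finite (Quotient _))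

instance (n : ℕ) : Fintype (BipClass n) := Fintype.ofFinite _

/-- The isomorphism class of a bipartite graph with edge set `Fin n`. -/
def BipClass.mk {n : ℕ} (Γ : BipGraph (Fin n)) : BipClass n := Quotient.mk _ Γ

/-- The vector space with basis the isomorphism classes of bipartite graphs of degree `n`. -/
abbrev B (n : ℕ) : Type := BipClass n →₀ ℂ

/-- The contribution `(|Aut (V₁, F, V₂')| / |Aut_F (V₁, F, V₂')|) [(V₁, F, V₂')]` of a gluing. -/
def gluingTerm {n : ℕ} {Γ Γ' : BipGraph (Fin n)} (G : Gluing Γ Γ') : B n :=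
  Finsupp.single (BipClass.mk G.glued) ((G.glued.autCard : ℂ) / (G.autCard : ℂ))

theorem gluingTerm_map {n : ℕ} {Γ Γ' Δ Δ' : BipGraph (Fin n)} {a b : Fin n ≃ Fin n}
    (ha : Γ.IsIso Δ a) (hb : Γ'.IsIso Δ' b) (G : Gluing Γ Γ') :
    gluingTerm (G.map ha hb) = gluingTerm G := by
  have hg := G.map_glued_isIso ha hb
  rw [gluingTerm, gluingTerm, G.map_autCard ha hb, ← autCard_congr hg,
    show BipClass.mk (G.map ha hb).glued = BipClass.mk G.glued from
      (Quotient.sound ⟨a, hg⟩ : BipClass.mk G.glued = _).symm]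

/-- The contribution of an equivalence class of gluings. -/
def gluingClassTerm {n : ℕ} {Γ Γ' : BipGraph (Fin n)} :
    Quotient (Gluing.setoid Γ Γ') → B n :=
  Quotient.lift gluingTerm (by
    intro G H h
    obtain ⟨a, b, ha, hb, rfl⟩ := Gluing.equivalent_iff_map.1 h
    exact (gluingTerm_map ha hb G).symm)

instance {n : ℕ} (Γ Γ' : BipGraph (Fin n)) : Fintype (Quotient (Gluing.setoid Γ Γ')) :=
  Fintype.ofFinite _

/-- The product of two graphs of degree `n`: the sum over all gluings, up to equivalence. -/
def graphMul {n : ℕ} (Γ Γ' : BipGraph (Fin n)) : B n :=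
  ∑ q : Quotient (Gluing.setoid Γ Γ'), gluingClassTerm q

theorem graphMul_congr {n : ℕ} {Γ Γ' Δ Δ' : BipGraph (Fin n)} {a b : Fin n ≃ Fin n}
    (ha : Γ.IsIso Δ a) (hb : Γ'.IsIso Δ' b) : graphMul Γ Γ' = graphMul Δ Δ' := by
  refine Fintype.sum_equiv (Gluing.mapQuotient ha hb) _ _ fun q => ?_
  induction q using Quotient.inductionOn with
  | h G => exact (gluingTerm_map ha hb G).symm

/-- The product of two isomorphism classes of graphs of degree `n`. -/
def classMul {n : ℕ} : BipClass n → BipClass n → B n :=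
  Quotient.lift₂ graphMul fun _ _ _ _ ⟨_, ha⟩ ⟨_, hb⟩ => graphMul_congr ha hb

/-- The bilinear product `*` on `B n`. -/
def mul (n : ℕ) : B n →ₗ[ℂ] B n →ₗ[ℂ] B n :=
  Finsupp.lift _ ℂ _ fun Γ => Finsupp.lift _ ℂ _ fun Γ' => classMul Γ Γ'

/-- The order of the automorphism group of (any representative of) a class. -/
def BipClass.autCard {n : ℕ} : BipClass n → ℕ :=
  Quotient.lift BipGraph.autCard fun _ _ ⟨_, h⟩ => autCard_congr h

/-- The class consists of simple graphs. -/
def BipClass.IsSimple {n : ℕ} : BipClass n → Prop :=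
  Quotient.lift BipGraph.IsSimple fun _ _ ⟨_, h⟩ =>
    propext ⟨fun hs => hs.of_iso h, fun hs => hs.of_iso h.symm⟩

/-- The bijection of the edge sets that numbers the edges of a disjoint union. -/
def sumEquiv {m n : ℕ} (h : m ≤ n) : Fin m ⊕ Fin (n - m) ≃ Fin n :=
  finSumFinEquiv.trans (finCongr (Nat.add_sub_of_le h))

/-- The class of the disjoint union of a graph of degree `m` and a graph of degree `n - m`. -/
def BipClass.extend {m n : ℕ} (h : m ≤ n) : BipClass m → BipClass (n - m) → BipClass n :=
  Quotient.lift₂ (fun Γ S => BipClass.mk ((Γ.disjUnion S).relabel (sumEquiv h)))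
    fun _ _ _ _ ⟨_, ha⟩ ⟨_, hb⟩ => Quotient.sound ⟨_, ((relabel_isIso _ _).symm.trans
      (disjUnion_isIso ha hb)).trans (relabel_isIso _ _)⟩

open Classical in
/-- The sum of `|Aut Γ̃| / (|Aut Γ| |Aut (Γ̃ \ Γ)|) Γ̃` over the standard extensions `Γ̃` of degree
`n` of a graph `Γ` of degree `m ≤ n`: the disjoint unions of `Γ` and a simple graph `S = Γ̃ \ Γ` of
degree `n - m`. -/
def classRho {m n : ℕ} (h : m ≤ n) (Γ : BipClass m) : B n :=
  ∑ S : BipClass (n - m) with S.IsSimple,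
    Finsupp.single (Γ.extend h S)
      (((Γ.extend h S).autCard : ℂ) / ((Γ.autCard : ℂ) * (S.autCard : ℂ)))

/-- The linear map `ρₙ : B m → B n` for `m ≤ n` (it is not used for `n < m`, where it is set to
zero). -/
def rho (m n : ℕ) : B m →ₗ[ℂ] B n :=
  if h : m ≤ n then Finsupp.lift _ ℂ _ (classRho h) else 0

/-- The product `Γ₁ *ₙ Γ₂ = ρₙ(Γ₁) * ρₙ(Γ₂)` for graphs of degrees not greater than `n`. -/
def starMul {m₁ m₂ : ℕ} (Γ₁ : BipClass m₁) (Γ₂ : BipClass m₂) (n : ℕ) : B n :=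
  mul n (rho m₁ n (Finsupp.single Γ₁ 1)) (rho m₂ n (Finsupp.single Γ₂ 1))

/-- The components `{Γ₁ Γ₂}ₙ`, defined recursively for `n ≥ max |Γ₁| |Γ₂|` (and set to zero
below, where they are not used). -/
def bracket {m₁ m₂ : ℕ} (Γ₁ : BipClass m₁) (Γ₂ : BipClass m₂) (n : ℕ) : B n :=
  if n < max m₁ m₂ then 0
  else starMul Γ₁ Γ₂ n -
    ∑ k ∈ (Ico (max m₁ m₂) n).attach, rho k.1 n (bracket Γ₁ Γ₂ k.1)
termination_by n
decreasing_by exact (Finset.mem_Ico.1 k.2).2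

/-- The vector space with basis the isomorphism classes of all bipartite graphs. -/
abbrev BInf : Type := (Σ n, BipClass n) →₀ ℂ

/-- The inclusion of `B n` into `BInf`. -/
def incl (n : ℕ) : B n →ₗ[ℂ] BInf := Finsupp.lmapDomain ℂ ℂ (Sigma.mk n)

/-- The product `Γ₁ ∘ Γ₂`, the sum of `{Γ₁ Γ₂}ₙ` over all `n ≥ max |Γ₁| |Γ₂|`. -/
def classCirc {m₁ m₂ : ℕ} (Γ₁ : BipClass m₁) (Γ₂ : BipClass m₂) : BInf :=
  ∑ᶠ (n : ℕ) (_ : max m₁ m₂ ≤ n), incl n (bracket Γ₁ Γ₂ n)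

/-- The bilinear product `∘` on `BInf`. -/
def circ : BInf →ₗ[ℂ] BInf →ₗ[ℂ] BInf :=
  Finsupp.lift _ ℂ _ fun Γ₁ => Finsupp.lift _ ℂ _ fun Γ₂ => classCirc Γ₁.2 Γ₂.2

end BipartiteGraphs

end

noncomputable section

namespace BipartiteGraphs

open BipGraph

open scoped Classical

/-! ### Isomorphism classes and counts of isomorphisms -/

namespace BipGraph

variable {E E' D D' : Type}

/-! A graph on `Fin n` is a pair `(p, q)` of partitions of the edges, so an element of `B n` is a
matrix indexed by partitions, invariant under simultaneous relabelling. In this picture `*` is the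
matrix product (`mul_apply`): by orbit-stabiliser, the automorphism factors turn a sum over classes
of gluings into a count of middle partitions. Hence `*` is associative.

The extension map also becomes a count (`rhoTot_apply`): the entry of `rhoTot n x` at `Δ` is the sum
of `x` over the subgraphs `Δ|Z` whose complement splits off as a simple graph. The term `Z = univ`
is the coefficient of `Δ` and the others have smaller degree, so the maps `rhoTot n` are jointly
injective (`eq_zero_of_rhoTot`).

A product of two extensions is thus a sum over a middle partition `q` and two sets `X`, `Y`. Off `X
∪ Y` all three partitions agree, so grouping by `Z = X ∪ Y` leaves a sum over data on `Z` with `X`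
and `Y` covering `Z` (`mul_rhoTot_apply`). These covering sums satisfy the recursion for `{Γ₁ Γ₂}ₙ`
(`bracket_eq_component`). They vanish for `n > |Γ₁| + |Γ₂|`, as two sets cannot cover more edges
than they contain. Therefore each `rhoTot n` carries `∘` to `*` (`rhoTot_circ`), and joint
injectivity transfers associativity. -/

theorem eq_iff_left_right {Γ Δ : BipGraph E} : Γ = Δ ↔ Γ.left = Δ.left ∧ Γ.right = Δ.right := by
  cases Γ; cases Δ; simp

instance [Finite E] : Finite (Setoid E) :=
  Finite.of_injective (fun s : Setoid E => (⟨s, s⟩ : BipGraph E)) fun s t h => by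
    simpa [eq_iff_left_right] using h

instance [Finite E] : Fintype (Setoid E) := Fintype.ofFinite _

/-- The pull-back of a bipartite graph along a map into its edge set. -/
def comap (Γ : BipGraph E) (i : D → E) : BipGraph D := ⟨Γ.left.comap i, Γ.right.comap i⟩

@[simp] theorem comap_left (Γ : BipGraph E) (i : D → E) : (Γ.comap i).left = Γ.left.comap i := rfl

@[simp] theorem comap_right (Γ : BipGraph E) (i : D → E) :
    (Γ.comap i).right = Γ.right.comap i := rfl

theorem comap_comap (Γ : BipGraph E) (i : D → E) (j : D' → D) :
    (Γ.comap i).comap j = Γ.comap (i ∘ j) := rfl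

theorem isIso_iff {Γ : BipGraph E} {Δ : BipGraph D} {a : E ≃ D} :
    Γ.IsIso Δ a ↔ Γ = Δ.comap a := by
  simp only [IsIso, end₁_eq, end₂_eq, eq_iff_left_right, Setoid.ext_iff, comap_left, comap_right,
    Setoid.comap_rel]
  exact ⟨fun h => ⟨fun e f => (h e f).1, fun e f => (h e f).2⟩,
    fun h e f => ⟨h.1 e f, h.2 e f⟩⟩

theorem comap_isIso (Δ : BipGraph D) (a : E ≃ D) : (Δ.comap a).IsIso Δ a := isIso_iff.2 rfl

/-- The isomorphism class of a bipartite graph with an arbitrary finite edge set. -/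
def cls [Finite E] (Γ : BipGraph E) : Σ n, BipClass n :=
  ⟨Nat.card E, BipClass.mk (Γ.comap (Finite.equivFin E).symm)⟩

theorem cls_mk {n : ℕ} (Γ : BipGraph (Fin n)) : cls Γ = ⟨n, BipClass.mk Γ⟩ := by
  -- `Nat.card (Fin n)` equals `n` only propositionally; a variable degree can be substituted away
  -- without casts.
  have key : ∀ (m : ℕ) (h : m = n) (a : Fin m ≃ Fin n),
      (⟨m, BipClass.mk (Γ.comap a)⟩ : Σ n, BipClass n) = ⟨n, BipClass.mk Γ⟩ := by
    rintro m rfl a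
    exact congrArg (Sigma.mk m) (Quotient.sound ⟨a, comap_isIso Γ a⟩)
  exact key _ (by simp) _

theorem cls_eq_iff [Finite E] [Finite D] {Γ : BipGraph E} {Δ : BipGraph D} :
    cls Γ = cls Δ ↔ ∃ a : E ≃ D, Γ = Δ.comap a := by
  constructor
  · intro h
    have key : ∀ (m n : ℕ) (u : E ≃ Fin m) (v : D ≃ Fin n),
        (⟨m, BipClass.mk (Γ.comap u.symm)⟩ : Σ n, BipClass n) =
          ⟨n, BipClass.mk (Δ.comap v.symm)⟩ → ∃ a : E ≃ D, Γ = Δ.comap a := by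
      intro m n u v h
      obtain rfl : m = n := congrArg Sigma.fst h
      obtain ⟨a, ha⟩ := Quotient.exact (eq_of_heq (Sigma.mk.inj h).2)
      refine ⟨(u.trans a).trans v.symm, isIso_iff.1 ?_⟩
      exact (((comap_isIso Γ u.symm).symm).trans ha).trans (comap_isIso Δ v.symm)
    exact key _ _ _ _ h
  · rintro ⟨a, rfl⟩
    have key : ∀ (m n : ℕ) (_ : m = n) (u : E ≃ Fin m) (v : D ≃ Fin n),
        (⟨m, BipClass.mk ((Δ.comap a).comap u.symm)⟩ : Σ n, BipClass n) =
          ⟨n, BipClass.mk (Δ.comap v.symm)⟩ := by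
      rintro m _ rfl u v
      refine congrArg (Sigma.mk m) (Quotient.sound ⟨(u.symm.trans a).trans v, ?_⟩)
      exact ((comap_isIso (Δ.comap a) u.symm).trans (comap_isIso Δ a)).trans
        (comap_isIso Δ v.symm).symm
    exact key _ _ (Nat.card_congr a) _ _

theorem cls_comap [Finite E] [Finite D] (Δ : BipGraph D) (a : E ≃ D) :
    cls (Δ.comap a) = cls Δ := cls_eq_iff.2 ⟨a, rfl⟩

theorem cls_eq_mk_iff [Finite E] {n : ℕ} {Γ : BipGraph E} {Δ : BipGraph (Fin n)} :
    cls Γ = ⟨n, BipClass.mk Δ⟩ ↔ ∃ a : E ≃ Fin n, Γ = Δ.comap a := by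
  rw [← cls_mk, cls_eq_iff]

theorem mk_eq_mk_iff {n : ℕ} {Γ Δ : BipGraph (Fin n)} :
    BipClass.mk Γ = BipClass.mk Δ ↔ cls Γ = cls Δ := by
  rw [cls_mk, cls_mk]
  simp

/-- The number of isomorphisms between two bipartite graphs. -/
def isoCount [Fintype E] [Fintype D] (Γ : BipGraph E) (Δ : BipGraph D) : ℕ :=
  ∑ a : E ≃ D, if Γ = Δ.comap a then 1 else 0

/-- Composing with the inverse of one fixed isomorphism turns isomorphisms into automorphisms. -/
theorem isoCount_eq [Fintype E] [Fintype D] (Γ : BipGraph E) (Δ : BipGraph D) :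
    isoCount Γ Δ = if cls Γ = cls Δ then Γ.autCard else 0 := by
  split_ifs with h
  · obtain ⟨c, hc⟩ := cls_eq_iff.1 h
    rw [autCard, Nat.card_eq_fintype_card, Fintype.card_subtype, Finset.card_filter, isoCount]
    refine Fintype.sum_equiv ((Equiv.refl E).equivCongr c.symm) _ _ fun a => ?_
    have : Γ = Δ.comap a ↔ Γ.IsIso Γ (((Equiv.refl E).equivCongr c.symm) a) := by
      rw [isIso_iff]
      conv_rhs => rw [hc, comap_comap]
      rw [← hc]
      apply Eq.congr rfl
      congr 1
      ext e
      simp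
    simp only [this]
  · refine Finset.sum_eq_zero fun a _ => if_neg fun ha => h (cls_eq_iff.2 ⟨a, ha⟩)

theorem autCard_pos [Finite E] (Γ : BipGraph E) : 0 < Γ.autCard :=
  have : Nonempty {a : E ≃ E // Γ.IsIso Γ a} := ⟨⟨_, IsIso.refl Γ⟩⟩
  Nat.card_pos

theorem autCard_eq_of_cls_eq [Finite E] [Finite D] {Γ : BipGraph E} {Δ : BipGraph D}
    (h : cls Γ = cls Δ) : Γ.autCard = Δ.autCard := by
  obtain ⟨a, ha⟩ := cls_eq_iff.1 h
  exact autCard_congr (isIso_iff.2 ha)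

theorem glued_eq {Γ : BipGraph E} {Γ' : BipGraph E'} (G : Gluing Γ Γ') :
    G.glued = ⟨Γ.left, Γ'.right.comap G.F⟩ := rfl

/-! ### Gluings as bijections, and the orbit count -/

namespace Gluing

theorem right_eq [Finite E] {Γ : BipGraph E} {Γ' : BipGraph E'} (G : Gluing Γ Γ') :
    Γ.right = Γ'.left.comap G.F := by
  ext e f
  simpa [Setoid.comap_rel] using G.end_iff e f

/-- Gluings correspond to the bijections of the edge sets that identify the relations in the
middle. -/
def equivSubtype [Finite E] (Γ : BipGraph E) (Γ' : BipGraph E') :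
    Gluing Γ Γ' ≃ {F : E ≃ E' // Γ.right = Γ'.left.comap F} where
  toFun G := ⟨G.F, G.right_eq⟩
  invFun F := ofEquiv F.1 fun e f => by
    simp only [end₁_eq, end₂_eq]
    have h := F.2
    rw [Setoid.ext_iff] at h
    exact h e f
  left_inv G := F_injective rfl
  right_inv F := rfl

theorem sum_eq [Fintype E] [Fintype E'] (Γ : BipGraph E) (Γ' : BipGraph E')
    [Fintype (Gluing Γ Γ')] {M : Type*} [AddCommMonoid M] (f : (E ≃ E') → M) :
    ∑ G : Gluing Γ Γ', f G.F = ∑ F : E ≃ E', if Γ.right = Γ'.left.comap F then f F else 0 := by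
  rw [← Finset.sum_filter]
  refine (Fintype.sum_equiv (equivSubtype Γ Γ') _ (fun F => f F.1) fun _ => rfl).trans
    (Finset.sum_subtype _ (fun F => ?_) f).symm
  simp

instance [Finite E] [Finite E'] (Γ : BipGraph E) (Γ' : BipGraph E') : Fintype (Gluing Γ Γ') :=
  Fintype.ofFinite _

/-- The number of ways of putting two graphs into a composable position over given outer
partitions. -/
theorem sum_isoCount_mul_isoCount [Fintype E] (Γ Γ' : BipGraph E) (p r : Setoid E) :
    ∑ q : Setoid E, isoCount Γ ⟨p, q⟩ * isoCount Γ' ⟨q, r⟩ =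
      ∑ G : Gluing Γ Γ', isoCount G.glued ⟨p, r⟩ := by
  have hL : ∑ q : Setoid E, isoCount Γ ⟨p, q⟩ * isoCount Γ' ⟨q, r⟩ =
      ∑ a : E ≃ E, ∑ b : E ≃ E, if Γ.left = p.comap a ∧ Γ'.right = r.comap b ∧
        Γ.right.comap a.symm = Γ'.left.comap b.symm then 1 else 0 := by
    simp only [isoCount, Finset.sum_mul_sum]
    rw [Finset.sum_comm]
    refine Finset.sum_congr rfl fun a _ => ?_
    rw [Finset.sum_comm]
    refine Finset.sum_congr rfl fun b _ => ?_
    have h1 : ∀ (s t : Setoid E) (c : E ≃ E), s = t.comap c ↔ t = s.comap c.symm := by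
      intro s t c
      constructor <;> rintro rfl <;> ext x y <;> simp [Setoid.comap_rel]
    -- The isomorphism `a` forces the middle partition: it is the image of `Γ.right`.
    rw [Finset.sum_eq_single (Γ.right.comap a.symm)]
    · simp only [eq_iff_left_right, comap_left, comap_right, mul_ite, mul_one, mul_zero, ← ite_and]
      congr 1
      rw [h1 Γ.right, h1 Γ'.left]
      simp only [and_true, eq_iff_iff]
      tauto
    · intro q _ hq
      rw [if_neg, zero_mul]
      intro h
      exact hq ((h1 _ _ _).1 (eq_iff_left_right.1 h).2)
    · simp
  have hR : ∑ G : Gluing Γ Γ', isoCount G.glued ⟨p, r⟩ =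
      ∑ a : E ≃ E, ∑ F : E ≃ E, if Γ.right = Γ'.left.comap F then
        (if Γ.left = p.comap a ∧ Γ'.right.comap F = r.comap a then 1 else 0) else 0 := by
    simp only [isoCount]
    rw [Finset.sum_comm]
    refine Finset.sum_congr rfl fun a _ => ?_
    rw [← sum_eq]
    refine Finset.sum_congr rfl fun G _ => ?_
    simp [eq_iff_left_right, glued_eq]
  rw [hL, hR]
  refine Finset.sum_congr rfl fun a _ => ?_
  -- For fixed `a`, the second isomorphism `b` and the gluing bijection `F = b⁻¹ ∘ a` determine each
  -- other.
  refine Fintype.sum_equiv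
    { toFun := fun b => a.trans b.symm
      invFun := fun F => F.symm.trans a
      left_inv := fun b => by ext; simp
      right_inv := fun F => by ext; simp } _ _ fun b => ?_
  have h1 : Γ'.right.comap (a.trans b.symm) = r.comap a ↔ Γ'.right = r.comap b := by
    simp only [Setoid.ext_iff, Setoid.comap_rel, Equiv.trans_apply]
    exact ⟨fun h x y => by simpa using h (a.symm (b x)) (a.symm (b y)),
      fun h x y => by simpa using h (b.symm (a x)) (b.symm (a y))⟩
  have h2 : Γ.right = Γ'.left.comap (a.trans b.symm) ↔
      Γ.right.comap a.symm = Γ'.left.comap b.symm := by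
    simp only [Setoid.ext_iff, Setoid.comap_rel, Equiv.trans_apply]
    exact ⟨fun h x y => by simpa using h (a.symm x) (a.symm y),
      fun h x y => by simpa using h (a x) (a y)⟩
  simp only [Equiv.coe_fn_mk, h1, h2, ← ite_and]
  congr 1
  simp only [eq_iff_iff]
  tauto

/-- Orbit-stabiliser for `Aut Γ × Aut Γ'` acting on gluings: the class is an orbit, and every fibre
of the orbit map is in bijection with `Aut_F`. -/
theorem card_class_mul_autCard [Finite E] [Finite E'] {Γ : BipGraph E} {Γ' : BipGraph E'}
    (G : Gluing Γ Γ') : Nat.card {H : Gluing Γ Γ' // H ≈ G} * G.autCard =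
      Γ.autCard * Γ'.autCard := by
  let A := {a : E ≃ E // Γ.IsIso Γ a} × {b : E' ≃ E' // Γ'.IsIso Γ' b}
  have hA : Nat.card A = Γ.autCard * Γ'.autCard := Nat.card_prod _ _
  let φ : A → {H : Gluing Γ Γ' // H ≈ G} := fun u => ⟨G.map u.1.2 u.2.2,
    Setoid.symm (equivalent_iff_map.2 ⟨_, _, u.1.2, u.2.2, rfl⟩)⟩
  have hfib : ∀ H, Nat.card {u : A // φ u = H} = G.autCard := by
    rintro ⟨H, hH⟩
    obtain ⟨a, b, ha, hb, rfl⟩ := equivalent_iff_map.1 (Setoid.symm hH)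
    have hF : ∀ (u : A), φ u = ⟨G.map ha hb, hH⟩ ↔
        ∀ e, u.2.1 (G.F (u.1.1.symm e)) = b (G.F (a.symm e)) := by
      intro u
      rw [Subtype.ext_iff, ← F_injective.eq_iff, Equiv.ext_iff]
      rfl
    -- The second component of a stabilising pair is `F c F⁻¹`. It respects `Γ'.left` because `F`
    -- matches it with `Γ.right`, and `Γ'.right` because that is the right side of the glued graph.
    have hcomp : ∀ (c : E ≃ E), Γ.IsIso Γ c → G.glued.IsIso G.glued c →
        Γ'.IsIso Γ' ((G.F.symm.trans c).trans G.F) := by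
      intro c hc hc' x y
      constructor
      · have h1 := G.end_iff (G.F.symm x) (G.F.symm y)
        have h2 := G.end_iff (c (G.F.symm x)) (c (G.F.symm y))
        have h3 := (hc (G.F.symm x) (G.F.symm y)).2
        simp only [Equiv.apply_symm_apply] at h1
        simp only [Equiv.trans_apply]
        rw [← h1, ← h2, h3]
      · have h3 := (hc' (G.F.symm x) (G.F.symm y)).2
        simpa [glued, Setoid.comap_rel] using h3
    refine Nat.card_congr
      { toFun := fun u => ⟨u.1.1.1.trans a.symm, ?_, u.1.1.2.trans ha.symm⟩
        invFun := fun c => ⟨⟨⟨c.1.trans a, c.2.2.trans ha⟩,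
          ⟨((G.F.symm.trans c.1).trans G.F).trans b, (hcomp _ c.2.2 c.2.1).trans hb⟩⟩, ?_⟩
        left_inv := ?_
        right_inv := ?_ }
    · obtain ⟨u, hu⟩ := u
      rw [hF] at hu
      have hu' : ∀ e, G.F (a.symm (u.1.1 e)) = b.symm (u.2.1 (G.F e)) := fun e => by
        rw [Equiv.eq_symm_apply, ← hu, Equiv.symm_apply_apply]
      intro x y
      constructor
      · exact ((u.1.2.trans ha.symm) x y).1
      · have h3 := ((u.2.2.trans hb.symm) (G.F x) (G.F y)).2
        simp only [end₂_eq, Equiv.trans_apply] at h3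
        simp only [end₂_eq, glued, Setoid.comap_rel, Equiv.trans_apply, hu']
        exact h3
    · rw [hF]
      intro e
      simp
    · rintro ⟨u, hu⟩
      rw [hF] at hu
      refine Subtype.ext (Prod.ext (Subtype.ext ?_) (Subtype.ext ?_))
      · ext e
        simp
      · ext e
        have := hu (u.1.1 (G.F.symm e))
        simp only [Equiv.symm_apply_apply, Equiv.apply_symm_apply] at this
        simp [this]
    · rintro ⟨c, hc⟩
      refine Subtype.ext ?_
      ext e
      simp
  rw [← hA, ← Nat.card_congr (Equiv.sigmaFiberEquiv φ), Nat.card_sigma]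
  simp [hfib]

theorem autCard_pos [Finite E] {Γ : BipGraph E} {Γ' : BipGraph E'} (G : Gluing Γ Γ') :
    0 < G.autCard :=
  have : Nonempty {a : E ≃ E // G.glued.IsIso G.glued a ∧ Γ.IsIso Γ a} :=
    ⟨⟨_, IsIso.refl _, IsIso.refl _⟩⟩
  Nat.card_pos

end Gluing

end BipGraph

/-! ### The product as a matrix product -/

/-- The product of two graphs as a sum over all gluings. -/
theorem graphMul_eq_sum {n : ℕ} (Γ Γ' : BipGraph (Fin n)) :
    graphMul Γ Γ' = ∑ G : Gluing Γ Γ', Finsupp.single (BipClass.mk G.glued)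
      ((G.glued.autCard : ℂ) / (Γ.autCard * Γ'.autCard)) := by
  -- By orbit-stabiliser, each summand is the class contribution divided by the class size.
  have hterm : ∀ G : Gluing Γ Γ', Finsupp.single (BipClass.mk G.glued)
      ((G.glued.autCard : ℂ) / (Γ.autCard * Γ'.autCard)) =
        (Nat.card {H : Gluing Γ Γ' // H ≈ G} : ℂ)⁻¹ • gluingTerm G := by
    intro G
    rw [gluingTerm, Finsupp.smul_single, smul_eq_mul]
    congr 1
    have h := G.card_class_mul_autCard
    have h0 : (G.autCard : ℂ) ≠ 0 := Nat.cast_ne_zero.2 G.autCard_pos.ne'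
    have h1 : (Nat.card {H : Gluing Γ Γ' // H ≈ G} : ℂ) ≠ 0 := by
      have : Nonempty {H : Gluing Γ Γ' // H ≈ G} := ⟨⟨G, Setoid.refl G⟩⟩
      exact Nat.cast_ne_zero.2 Nat.card_pos.ne'
    rw [← Nat.cast_mul, ← h]
    push_cast
    field_simp
  rw [graphMul, ← Finset.sum_fiberwise (s := univ)
    (g := fun G : Gluing Γ Γ' => (Quotient.mk _ G : Quotient (Gluing.setoid Γ Γ')))]
  refine Finset.sum_congr rfl fun q _ => ?_
  induction q using Quotient.inductionOn with
  | h G =>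
    have hc : ∀ H ∈ univ.filter fun H : Gluing Γ Γ' =>
        (Quotient.mk _ H : Quotient (Gluing.setoid Γ Γ')) = Quotient.mk _ G,
        Finsupp.single (BipClass.mk H.glued)
          ((H.glued.autCard : ℂ) / (Γ.autCard * Γ'.autCard)) =
        (Nat.card {H : Gluing Γ Γ' // H ≈ G} : ℂ)⁻¹ • gluingTerm G := by
      intro H hH
      have hHG : H ≈ G := Quotient.exact (Finset.mem_filter.1 hH).2
      rw [hterm]
      congr 1
      · congr 2
        refine Nat.card_congr (Equiv.subtypeEquivRight fun K => ?_)
        exact ⟨fun h => Setoid.trans h hHG, fun h => Setoid.trans h (Setoid.symm hHG)⟩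
      · exact congrArg gluingClassTerm (Quotient.sound hHG)
    have hcard : (univ.filter fun H : Gluing Γ Γ' =>
        (Quotient.mk _ H : Quotient (Gluing.setoid Γ Γ')) = Quotient.mk _ G).card =
        Nat.card {H : Gluing Γ Γ' // H ≈ G} := by
      rw [Nat.card_eq_fintype_card, Fintype.card_subtype]
      congr 1
      ext H
      simp only [Finset.mem_filter, Finset.mem_univ, true_and]
      exact Quotient.eq
    have h1 : (Nat.card {H : Gluing Γ Γ' // H ≈ G} : ℂ) ≠ 0 := by
      have : Nonempty {H : Gluing Γ Γ' // H ≈ G} := ⟨⟨G, Setoid.refl G⟩⟩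
      exact Nat.cast_ne_zero.2 Nat.card_pos.ne'
    rw [Finset.sum_congr rfl hc, Finset.sum_const, hcard, ← Nat.cast_smul_eq_nsmul ℂ, smul_smul,
      mul_inv_cancel₀ h1, one_smul]
    rfl

/-- This is `sum_isoCount_mul_isoCount` divided by `|Aut Γ| |Aut Γ'|`, since `isoCount` is an
automorphism number times an indicator. -/
theorem graphMul_apply {n : ℕ} (Γ Γ' : BipGraph (Fin n)) (p r : Setoid (Fin n)) :
    graphMul Γ Γ' (BipClass.mk ⟨p, r⟩) = ∑ q : Setoid (Fin n),
      (if BipClass.mk Γ = BipClass.mk ⟨p, q⟩ then 1 else 0) *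
        (if BipClass.mk Γ' = BipClass.mk ⟨q, r⟩ then 1 else 0) := by
  have h0 : ∀ Θ : BipGraph (Fin n), (Θ.autCard : ℂ) ≠ 0 := fun Θ =>
    Nat.cast_ne_zero.2 Θ.autCard_pos.ne'
  have h := congrArg (Nat.cast : ℕ → ℂ) (Gluing.sum_isoCount_mul_isoCount Γ Γ' p r)
  simp only [isoCount_eq, ← mk_eq_mk_iff] at h
  rw [graphMul_eq_sum, Finsupp.finsetSum_apply]
  simp only [Finsupp.single_apply]
  have hl : ∀ G : Gluing Γ Γ', (if BipClass.mk G.glued = BipClass.mk ⟨p, r⟩ then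
      (G.glued.autCard : ℂ) / (Γ.autCard * Γ'.autCard) else 0) =
      ((if BipClass.mk G.glued = BipClass.mk ⟨p, r⟩ then G.glued.autCard else 0 : ℕ) : ℂ) /
        (Γ.autCard * Γ'.autCard) := by
    intro G
    split_ifs <;> simp
  rw [Finset.sum_congr rfl fun G _ => hl G, ← Finset.sum_div, ← Nat.cast_sum, ← h, Nat.cast_sum,
    Finset.sum_div]
  refine Finset.sum_congr rfl fun q _ => ?_
  have h1 := h0 Γ
  have h2 := h0 Γ'
  split_ifs <;> simp [h1, h2]

/-- The product of `B n` is the matrix product, if elements of `B n` are considered as matrices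
with rows and columns indexed by the partitions of the set of edges. -/
theorem mul_apply {n : ℕ} (x y : B n) (p r : Setoid (Fin n)) :
    mul n x y (BipClass.mk ⟨p, r⟩) = ∑ q : Setoid (Fin n),
      x (BipClass.mk ⟨p, q⟩) * y (BipClass.mk ⟨q, r⟩) := by
  induction x using Finsupp.induction_linear with
  | zero => simp
  | add x x' hx hx' => simp [hx, hx', add_mul, Finset.sum_add_distrib]
  | single c z =>
    induction y using Finsupp.induction_linear with
    | zero => simp
    | add y y' hy hy' => simp [hy, hy', mul_add, Finset.sum_add_distrib]
    | single d w =>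
      induction c using Quotient.inductionOn with
      | h Γ =>
        induction d using Quotient.inductionOn with
        | h Γ' =>
          have : mul n (Finsupp.single (BipClass.mk Γ) z) (Finsupp.single (BipClass.mk Γ') w) =
              z • w • graphMul Γ Γ' := by
            simp [mul]
            rfl
          change mul n (Finsupp.single (BipClass.mk Γ) z) (Finsupp.single (BipClass.mk Γ') w) _ =
            ∑ q : Setoid (Fin n), Finsupp.single (BipClass.mk Γ) z _ *
              Finsupp.single (BipClass.mk Γ') w _
          rw [this, Finsupp.smul_apply, Finsupp.smul_apply, graphMul_apply, Finset.smul_sum,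
            Finset.smul_sum]
          refine Finset.sum_congr rfl fun q _ => ?_
          simp only [Finsupp.single_apply]
          split_ifs <;> simp

theorem mul_mul {n : ℕ} (x y z : B n) : mul n (mul n x y) z = mul n x (mul n y z) := by
  ext c
  induction c using Quotient.inductionOn with
  | h Γ =>
    obtain ⟨p, r⟩ := Γ
    change mul n (mul n x y) z (BipClass.mk ⟨p, r⟩) = mul n x (mul n y z) (BipClass.mk ⟨p, r⟩)
    simp only [mul_apply, Finset.sum_mul, Finset.mul_sum]
    rw [Finset.sum_comm]
    simp only [mul_assoc]

/-! ### Splitting off a simple graph -/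

namespace BipGraph

variable {E E' D D' : Type}

/-- The set `Z` is a union of classes of `s`. -/
def Saturated (s : Setoid E) (Z : Set E) : Prop := ∀ e f, s e f → (e ∈ Z ↔ f ∈ Z)

/-- The subgraph with a given set of edges. -/
def induce (Γ : BipGraph E) (Z : Set E) : BipGraph Z := Γ.comap Subtype.val

/-- The graph is the disjoint union of its subgraph with the edges in `Z` and a simple graph. -/
def SimpleOff (Γ : BipGraph E) (Z : Set E) : Prop :=
  Saturated Γ.left Z ∧ ∀ e, e ∉ Z → ∀ f, Γ.left e f ↔ Γ.right e f

/-- An edge off `Z` has the same left and right class, so the left-sided definition of `SimpleOff`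
is in fact symmetric. -/
theorem SimpleOff.saturated_right {Γ : BipGraph E} {Z : Set E} (h : Γ.SimpleOff Z) :
    Saturated Γ.right Z := by
  intro e f hef
  by_cases he : e ∈ Z
  · by_cases hf : f ∈ Z
    · simp [he, hf]
    · exact h.1 e f (Γ.left.symm ((h.2 f hf e).2 (Γ.right.symm hef)))
  · exact h.1 e f ((h.2 e he f).2 hef)

theorem isSimple_iff {Γ : BipGraph E} : Γ.IsSimple ↔ Γ.left = Γ.right := by
  constructor
  · intro h
    ext e f
    constructor
    · intro hef
      exact Γ.end₂_eq.1 (h e f ((le_sup_left : Γ.left ≤ Γ.left ⊔ Γ.right) hef)).2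
    · intro hef
      exact Γ.end₁_eq.1 (h e f ((le_sup_right : Γ.right ≤ Γ.left ⊔ Γ.right) hef)).1
  · intro h e f hef
    rw [end₁_eq, end₂_eq, ← h]
    rw [← h, sup_idem] at hef
    exact ⟨hef, hef⟩

theorem simpleOff_iff {Γ : BipGraph E} {Z : Set E} : Γ.SimpleOff Z ↔
    (Saturated Γ.left Z ∧ Saturated Γ.right Z) ∧ (Γ.induce Zᶜ).IsSimple := by
  rw [isSimple_iff, Setoid.ext_iff]
  constructor
  · exact fun h => ⟨⟨h.1, h.saturated_right⟩, fun e f => h.2 e e.2 f⟩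
  · refine fun h => ⟨h.1.1, fun e he f => ?_⟩
    by_cases hf : f ∈ Z
    · exact ⟨fun hef => absurd ((h.1.1 e f hef).2 hf) he,
        fun hef => absurd ((h.1.2 e f hef).2 hf) he⟩
    · exact h.2 ⟨e, he⟩ ⟨f, hf⟩

theorem disjUnion_eq_comap_iff {Γ : BipGraph D} {S : BipGraph D'} {Δ : BipGraph E} {Z : Set E}
    (a : D ≃ Z) (b : D' ≃ (Zᶜ : Set E)) :
    Γ.disjUnion S = Δ.comap ((a.sumCongr b).trans (Equiv.Set.sumCompl Z)) ↔
      (Saturated Δ.left Z ∧ Saturated Δ.right Z) ∧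
        Γ = (Δ.induce Z).comap a ∧ S = (Δ.induce Zᶜ).comap b := by
  have key : ∀ (s : Setoid E) (u : Setoid D) (v : Setoid D'),
      Setoid.ker (Sum.map (Quotient.mk u) (Quotient.mk v)) =
        s.comap ((a.sumCongr b).trans (Equiv.Set.sumCompl Z)) ↔
      Saturated s Z ∧ u = (s.comap Subtype.val).comap a ∧ v = (s.comap Subtype.val).comap b := by
    intro s u v
    simp only [Setoid.ext_iff, Setoid.ker_def, Setoid.comap_rel, Sum.forall, Sum.map_inl,
      Sum.map_inr, Equiv.trans_apply, Equiv.sumCongr_apply, Sum.inl.injEq, Sum.inr.injEq,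
      reduceCtorEq, false_iff, Equiv.Set.sumCompl_apply_inl, Equiv.Set.sumCompl_apply_inr,
      Quotient.eq]
    constructor
    · intro h
      refine ⟨fun e f hef => ?_, fun x y => (h.1 x).1 y, fun x y => (h.2 x).2 y⟩
      by_cases he : e ∈ Z <;> by_cases hf : f ∈ Z <;> simp only [he, hf]
      · have := (h.1 (a.symm ⟨e, he⟩)).2 (b.symm ⟨f, hf⟩)
        simp only [Equiv.apply_symm_apply] at this
        exact absurd hef this
      · have := (h.2 (b.symm ⟨e, he⟩)).1 (a.symm ⟨f, hf⟩)
        simp only [Equiv.apply_symm_apply] at this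
        exact absurd hef this
    · rintro ⟨h, hu, hv⟩
      refine ⟨fun x => ⟨hu x, fun y hxy => ?_⟩, fun x => ⟨fun y hxy => ?_, hv x⟩⟩
      · exact (b y).2 ((h _ _ hxy).1 (a x).2)
      · exact (b x).2 ((h _ _ hxy).2 (a y).2)
  rw [eq_iff_left_right, eq_iff_left_right, eq_iff_left_right]
  have h1 := key Δ.left Γ.left S.left
  have h2 := key Δ.right Γ.right S.right
  simp only [induce, comap_left, comap_right]
  refine (and_congr h1 h2).trans ?_
  tauto

/-- The isomorphisms of a disjoint union to a graph. -/
theorem isoCount_disjUnion [Fintype D] [Fintype D'] [Fintype E] (Γ : BipGraph D)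
    (S : BipGraph D') (Δ : BipGraph E) : isoCount (Γ.disjUnion S) Δ =
      ∑ Z : Set E, if Saturated Δ.left Z ∧ Saturated Δ.right Z then
        isoCount Γ (Δ.induce Z) * isoCount S (Δ.induce Zᶜ) else 0 := by
  -- Isomorphisms are grouped by the image `Z` of the first summand; each then splits into
  -- bijections onto `Z` and its complement.
  rw [isoCount, ← Finset.sum_fiberwise
    (g := fun c : D ⊕ D' ≃ E => Set.range (c ∘ Sum.inl))]
  refine Finset.sum_congr rfl fun Z _ => ?_
  have hR : (if Saturated Δ.left Z ∧ Saturated Δ.right Z then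
        isoCount Γ (Δ.induce Z) * isoCount S (Δ.induce Zᶜ) else 0) =
      ∑ u : (D ≃ Z) × (D' ≃ (Zᶜ : Set E)), if Γ.disjUnion S = Δ.comap
        ((u.1.sumCongr u.2).trans (Equiv.Set.sumCompl Z)) then 1 else 0 := by
    simp only [isoCount, Finset.sum_mul_sum, disjUnion_eq_comap_iff, Fintype.sum_prod_type]
    split_ifs with h
    · simp only [h, and_self, true_and, ite_and, mul_ite, mul_one, mul_zero]
      refine Finset.sum_congr (Finset.ext fun _ => by simp) fun a _ =>
        Finset.sum_congr (Finset.ext fun _ => by simp) fun b _ => ?_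
      split_ifs <;> rfl
    · simp [h]
  rw [hR]
  symm
  refine Finset.sum_bij (fun u _ => (u.1.sumCongr u.2).trans (Equiv.Set.sumCompl Z)) ?_ ?_ ?_ ?_
  · rintro ⟨a, b⟩ -
    simp only [Finset.mem_filter, Finset.mem_univ, true_and]
    ext e
    constructor
    · rintro ⟨d, rfl⟩
      simp
    · intro he
      exact ⟨a.symm ⟨e, he⟩, by simp⟩
  · rintro ⟨a, b⟩ - ⟨a', b'⟩ - h
    rw [Equiv.ext_iff] at h
    refine Prod.ext (Equiv.ext fun d => Subtype.ext ?_) (Equiv.ext fun d => Subtype.ext ?_)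
    · simpa using h (Sum.inl d)
    · simpa using h (Sum.inr d)
  · intro c hc
    simp only [Finset.mem_filter, Finset.mem_univ, true_and] at hc
    have ha : ∀ d, c (Sum.inl d) ∈ Z := fun d => hc ▸ ⟨d, rfl⟩
    have hb : ∀ d, c (Sum.inr d) ∈ Zᶜ := fun d hd => by
      rw [← hc] at hd
      obtain ⟨d', hd'⟩ := hd
      exact Sum.inl_ne_inr (c.injective hd')
    have ha' : Function.Bijective fun d => (⟨c (Sum.inl d), ha d⟩ : Z) := by
      refine ⟨fun x y hxy => Sum.inl_injective (c.injective (congrArg Subtype.val hxy)), ?_⟩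
      rintro ⟨e, he⟩
      rw [← hc] at he
      obtain ⟨d, rfl⟩ := he
      exact ⟨d, rfl⟩
    have hb' : Function.Bijective fun d => (⟨c (Sum.inr d), hb d⟩ : (Zᶜ : Set E)) := by
      refine ⟨fun x y hxy => Sum.inr_injective (c.injective (congrArg Subtype.val hxy)), ?_⟩
      rintro ⟨e, he⟩
      obtain ⟨d | d, rfl⟩ := c.surjective e
      · exact absurd (ha d) he
      · exact ⟨d, rfl⟩
    refine ⟨(Equiv.ofBijective _ ha', Equiv.ofBijective _ hb'), Finset.mem_univ _, ?_⟩
    ext x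
    cases x <;> rfl
  · intros
    rfl

theorem isSimple_iff_of_cls_eq [Finite E] {n : ℕ} {Γ : BipGraph E} {S : BipClass n}
    (h : cls Γ = ⟨n, S⟩) : S.IsSimple ↔ Γ.IsSimple := by
  induction S using Quotient.inductionOn with
  | h Δ =>
    obtain ⟨a, ha⟩ := cls_eq_mk_iff.1 h
    exact ⟨fun hs => IsSimple.of_iso (isIso_iff.2 ha).symm hs,
      fun hs => IsSimple.of_iso (isIso_iff.2 ha) hs⟩

end BipGraph

/-! ### The extension maps as sums over subgraphs -/

theorem classRho_apply {m n : ℕ} (h : m ≤ n) (Γ : BipClass m) (Δ : BipGraph (Fin n)) :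
    classRho h Γ (BipClass.mk Δ) = ∑ Z : Set (Fin n), if Δ.SimpleOff Z then
      (if cls (Δ.induce Z) = ⟨m, Γ⟩ then 1 else 0) else 0 := by
  induction Γ using Quotient.inductionOn with
  | h Γ =>
  change classRho h (BipClass.mk Γ) (BipClass.mk Δ) = ∑ Z : Set (Fin n), if Δ.SimpleOff Z then
      (if cls (Δ.induce Z) = ⟨m, BipClass.mk Γ⟩ then 1 else 0) else 0
  -- Dividing the isomorphisms from `Γ ⊔ S` by `|Aut Γ| |Aut S|` counts the sets `Z` splitting `Δ`
  -- into copies of `Γ` and `S`.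
  have hterm : ∀ S : BipClass (n - m),
      Finsupp.single ((BipClass.mk Γ).extend h S) ((((BipClass.mk Γ).extend h S).autCard : ℂ) /
        (((BipClass.mk Γ).autCard : ℂ) * (S.autCard : ℂ))) (BipClass.mk Δ) =
      ∑ Z : Set (Fin n), if Saturated Δ.left Z ∧ Saturated Δ.right Z then
        (if cls (Δ.induce Z) = ⟨m, BipClass.mk Γ⟩ ∧ cls (Δ.induce Zᶜ) = ⟨n - m, S⟩
          then 1 else 0) else 0 := by
    intro S
    induction S using Quotient.inductionOn with
    | h S =>
    change Finsupp.single (BipClass.mk ((Γ.disjUnion S).relabel (sumEquiv h)))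
      ((((Γ.disjUnion S).relabel (sumEquiv h)).autCard : ℂ) / ((Γ.autCard : ℂ) * S.autCard))
      (BipClass.mk Δ) = ∑ Z : Set (Fin n), if Saturated Δ.left Z ∧ Saturated Δ.right Z then
        (if cls (Δ.induce Z) = ⟨m, BipClass.mk Γ⟩ ∧ cls (Δ.induce Zᶜ) = ⟨n - m, BipClass.mk S⟩
          then 1 else 0) else 0
    have h1 : (Γ.autCard : ℂ) ≠ 0 := Nat.cast_ne_zero.2 Γ.autCard_pos.ne'
    have h2 : (S.autCard : ℂ) ≠ 0 := Nat.cast_ne_zero.2 S.autCard_pos.ne'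
    have hc : cls ((Γ.disjUnion S).relabel (sumEquiv h)) = cls (Γ.disjUnion S) :=
      cls_comap (Γ.disjUnion S) (sumEquiv h).symm
    have hcount := congrArg (Nat.cast : ℕ → ℂ) (isoCount_disjUnion Γ S Δ)
    simp only [isoCount_eq] at hcount
    rw [Finsupp.single_apply, mk_eq_mk_iff, autCard_eq_of_cls_eq hc, hc]
    have hl : (if cls (Γ.disjUnion S) = cls Δ then
        ((Γ.disjUnion S).autCard : ℂ) / (Γ.autCard * S.autCard) else 0) =
        ((if cls (Γ.disjUnion S) = cls Δ then (Γ.disjUnion S).autCard else 0 : ℕ) : ℂ) /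
          (Γ.autCard * S.autCard) := by
      split_ifs <;> simp
    refine Eq.trans (by split_ifs <;> rfl) (hl.trans ?_)
    rw [hcount, Nat.cast_sum, Finset.sum_div]
    refine Finset.sum_congr rfl fun Z _ => ?_
    have e1 : cls (Δ.induce Z) = cls Γ ↔ cls Γ = cls (Δ.induce Z) := eq_comm
    have e2 : cls (Δ.induce Zᶜ) = cls S ↔ cls S = cls (Δ.induce Zᶜ) := eq_comm
    simp only [← cls_mk, e1, e2]
    by_cases c1 : cls Γ = cls (Δ.induce Z) <;> by_cases c2 : cls S = cls (Δ.induce Zᶜ) <;>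
      split_ifs <;> simp_all
  rw [classRho, Finsupp.finsetSum_apply, Finset.sum_congr rfl fun S _ => hterm S, Finset.sum_comm]
  refine Finset.sum_congr rfl fun Z _ => ?_
  rw [simpleOff_iff]
  by_cases hs : Saturated Δ.left Z ∧ Saturated Δ.right Z
  · by_cases hm : cls (Δ.induce Z) = ⟨m, BipClass.mk Γ⟩
    -- The complement has degree `n - m`, so exactly one class `T` in the sum over `S` matches it.
    · have hcard : Nat.card (Zᶜ : Set (Fin n)) = n - m := by
        have h1 : Nat.card Z = m := congrArg Sigma.fst hm
        have h2 := Set.ncard_add_ncard_compl Z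
        rw [Nat.card_fin] at h2
        rw [Nat.card_coe_set_eq] at h1 ⊢
        omega
      obtain ⟨T, hT⟩ : ∃ T : BipClass (n - m), cls (Δ.induce Zᶜ) = ⟨n - m, T⟩ := by
        rw [← hcard]
        exact ⟨_, rfl⟩
      have hTS := isSimple_iff_of_cls_eq hT
      simp only [hs, hm, hT, and_self, true_and, if_true, ← hTS, Sigma.mk.injEq, heq_eq_eq]
      rw [Finset.sum_ite_eq]
      simp
    · simp [hm]
  · simp [hs]

/-- The sum of the maps `ρₙ` over all degrees. -/
def rhoTot (n : ℕ) : BInf →ₗ[ℂ] B n :=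
  Finsupp.lift _ ℂ _ fun c => rho c.1 n (Finsupp.single c.2 1)

theorem rhoTot_single (n : ℕ) (c : Σ m, BipClass m) (z : ℂ) :
    rhoTot n (Finsupp.single c z) = z • rho c.1 n (Finsupp.single c.2 1) := by
  simp [rhoTot]

theorem rhoTot_incl (m n : ℕ) (x : B m) : rhoTot n (incl m x) = rho m n x := by
  induction x using Finsupp.induction_linear with
  | zero => simp
  | add x y hx hy => simp [hx, hy]
  | single c z =>
    have : incl m (Finsupp.single c z) = Finsupp.single ⟨m, c⟩ z := by simp [incl]
    rw [this, rhoTot_single, ← map_smul, Finsupp.smul_single, smul_eq_mul, mul_one]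

theorem rhoTot_apply (n : ℕ) (x : BInf) (Δ : BipGraph (Fin n)) :
    rhoTot n x (BipClass.mk Δ) =
      ∑ Z : Set (Fin n), if Δ.SimpleOff Z then x (cls (Δ.induce Z)) else 0 := by
  induction x using Finsupp.induction_linear with
  | zero => simp
  | add x y hx hy =>
    rw [map_add, Finsupp.add_apply, hx, hy, ← Finset.sum_add_distrib]
    refine Finset.sum_congr rfl fun Z _ => ?_
    split_ifs <;> simp
  | single c z =>
    obtain ⟨m, Γ⟩ := c
    rw [rhoTot_single]
    by_cases h : m ≤ n
    · rw [rho, dif_pos h]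
      have : Finsupp.lift (B n) ℂ _ (classRho h) (Finsupp.single Γ 1) = classRho h Γ := by simp
      rw [this, Finsupp.smul_apply, classRho_apply, Finset.smul_sum]
      refine Finset.sum_congr rfl fun Z _ => ?_
      by_cases hm : cls (Δ.induce Z) = ⟨m, Γ⟩
      · simp [hm]
      · simp [hm, Finsupp.single_eq_of_ne hm]
    -- The default value zero of `rho` is the correct one: no subset of `Fin n` has `m > n` edges.
    · rw [rho, dif_neg h, LinearMap.zero_apply, smul_zero, Finsupp.zero_apply]
      refine (Finset.sum_eq_zero fun Z _ => ?_).symm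
      rw [Finsupp.single_eq_of_ne, ite_self]
      intro hm
      have h1 : Nat.card Z = m := congrArg Sigma.fst hm
      have h2 : Nat.card Z ≤ Nat.card (Fin n) := Finite.card_subtype_le _
      rw [Nat.card_fin] at h2
      omega

theorem cls_induce_univ {n : ℕ} (Δ : BipGraph (Fin n)) :
    cls (Δ.induce Set.univ) = ⟨n, BipClass.mk Δ⟩ := by
  rw [← cls_mk]
  exact cls_comap Δ (Equiv.Set.univ (Fin n))

theorem simpleOff_univ {E : Type} (Δ : BipGraph E) : Δ.SimpleOff Set.univ :=
  ⟨fun _ _ _ => by simp, fun e he => absurd (Set.mem_univ e) he⟩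

/-- The maps `ρₙ` jointly determine an element of `BInf`. -/
theorem eq_zero_of_rhoTot {x : BInf} (h : ∀ n, rhoTot n x = 0) : x = 0 := by
  have key : ∀ (n : ℕ) (Γ : BipClass n), x ⟨n, Γ⟩ = 0 := by
    intro n
    induction n using Nat.strong_induction_on with
    | _ n ih =>
    intro Γ
    induction Γ using Quotient.inductionOn with
    | h Δ =>
    have h1 := rhoTot_apply n x Δ
    -- Triangularity: a proper subset `Z` gives a graph of smaller degree, where `x` vanishes by
    -- induction.
    rw [h n, Finset.sum_eq_single Set.univ, if_pos (simpleOff_univ Δ), cls_induce_univ] at h1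
    · exact h1.symm
    · intro Z _ hZ
      have : Nat.card Z < n := by
        rw [Nat.card_coe_set_eq]
        conv_rhs => rw [← Nat.card_fin n, ← Set.ncard_univ]
        exact Set.ncard_lt_ncard (Set.ssubset_univ_iff.2 hZ)
      rw [show x (cls (Δ.induce Z)) = 0 from ih _ this _, ite_self]
    · simp
  ext ⟨n, Γ⟩
  exact key n Γ

theorem rho_self (n : ℕ) (x : B n) : rho n n x = x := by
  ext c
  induction c using Quotient.inductionOn with
  | h Δ =>
  change rho n n x (BipClass.mk Δ) = x (BipClass.mk Δ)
  rw [← rhoTot_incl, rhoTot_apply, Finset.sum_eq_single Set.univ, if_pos (simpleOff_univ Δ),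
    cls_induce_univ]
  · exact Finsupp.mapDomain_apply sigma_mk_injective x _
  · intro Z _ hZ
    have : Nat.card Z < n := by
      rw [Nat.card_coe_set_eq]
      conv_rhs => rw [← Nat.card_fin n, ← Set.ncard_univ]
      exact Set.ncard_lt_ncard (Set.ssubset_univ_iff.2 hZ)
    have h0 : incl n x (cls (Δ.induce Z)) = 0 := by
      refine Finsupp.mapDomain_of_notMem_range _ _ ?_
      rintro ⟨c, hc⟩
      have : n = Nat.card Z := congrArg Sigma.fst hc
      omega
    rw [h0, ite_self]
  · simp

/-! ### Localising a product of extensions to the union of two edge sets -/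

namespace BipGraph

variable {E E' D D' : Type}

theorem SimpleOff.mono {Γ : BipGraph E} {X Z : Set E} (h : Γ.SimpleOff X)
    (hZ : Saturated Γ.left Z) (hXZ : X ⊆ Z) : Γ.SimpleOff Z :=
  ⟨hZ, fun e he f => h.2 e (fun h' => he (hXZ h')) f⟩

theorem Saturated.union {s : Setoid E} {X Y : Set E} (hX : Saturated s X) (hY : Saturated s Y) :
    Saturated s (X ∪ Y) := fun e f h => or_congr (hX e f h) (hY e f h)

/-- Edges off the range satisfy the condition by `hΔ`, and no class joins them to the range. -/
theorem simpleOff_comap_iff {Δ : BipGraph E} {i : D → E} (hΔ : Δ.SimpleOff (Set.range i))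
    {X : Set E} (hX : X ⊆ Set.range i) :
    (Δ.comap i).SimpleOff (i ⁻¹' X) ↔ Δ.SimpleOff X := by
  constructor
  · rintro ⟨h1, h2⟩
    refine ⟨fun e f hef => ?_, fun e he f => ?_⟩
    · by_cases he : e ∈ Set.range i
      · obtain ⟨f, rfl⟩ := (hΔ.1 e f hef).1 he
        obtain ⟨e, rfl⟩ := he
        exact h1 e f hef
      · exact iff_of_false (fun h => he (hX h)) fun h => he ((hΔ.1 e f hef).2 (hX h))
    · by_cases her : e ∈ Set.range i
      · by_cases hfr : f ∈ Set.range i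
        · obtain ⟨f, rfl⟩ := hfr
          obtain ⟨e, rfl⟩ := her
          exact h2 e he f
        · exact iff_of_false (fun h => hfr ((hΔ.1 _ _ h).1 her))
            fun h => hfr ((hΔ.saturated_right _ _ h).1 her)
      · exact hΔ.2 e her f
  · exact fun h => ⟨fun e f hef => h.1 _ _ hef, fun e he f => h.2 _ he _⟩

theorem cls_induce_comap [Finite E] [Finite D] (Δ : BipGraph E) {i : D → E}
    (hi : Function.Injective i) {X : Set E} (hX : X ⊆ Set.range i) :
    cls ((Δ.comap i).induce (i ⁻¹' X)) = cls (Δ.induce X) := by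
  have hb : Function.Bijective fun d : (i ⁻¹' X : Set D) => (⟨i d, d.2⟩ : X) := by
    refine ⟨fun x y h => Subtype.ext (hi (congrArg Subtype.val h)), ?_⟩
    rintro ⟨e, he⟩
    obtain ⟨d, rfl⟩ := hX he
    exact ⟨⟨d, he⟩, rfl⟩
  exact cls_comap (Δ.induce X) (Equiv.ofBijective _ hb)

/-- The contribution of a partition in the middle and of two sets of edges to the matrix product
of the images of `f` and `g` under the extension maps. -/
def weight [Finite E] (f g : (Σ n, BipClass n) → ℂ) (Γ : BipGraph E)
    (t : Setoid E × Set E × Set E) : ℂ :=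
  if SimpleOff ⟨Γ.left, t.1⟩ t.2.1 ∧ SimpleOff ⟨t.1, Γ.right⟩ t.2.2 then
    f (cls (induce ⟨Γ.left, t.1⟩ t.2.1)) * g (cls (induce ⟨t.1, Γ.right⟩ t.2.2)) else 0

instance [Finite E] : Fintype (Setoid E × Set E × Set E) := Fintype.ofFinite _

/-- The sum of the contributions of those pairs of sets that cover all edges. -/
def coverSum [Finite E] (f g : (Σ n, BipClass n) → ℂ) (Γ : BipGraph E) : ℂ :=
  ∑ t : Setoid E × Set E × Set E with t.2.1 ∪ t.2.2 = Set.univ, weight f g Γ t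

/-- The set `X` is saturated for `q` by the first factor and `Y` by the second, hence so is `X ∪ Y`.
Off `X` the left partition agrees with `q`, so it saturates `X ∪ Y` as well. -/
theorem simpleOff_of_weight_ne_zero [Finite E] {f g : (Σ n, BipClass n) → ℂ} {Γ : BipGraph E}
    {t : Setoid E × Set E × Set E} (h : weight f g Γ t ≠ 0) :
    SimpleOff ⟨Γ.left, t.1⟩ (t.2.1 ∪ t.2.2) ∧ SimpleOff ⟨t.1, Γ.right⟩ (t.2.1 ∪ t.2.2) := by
  obtain ⟨q, X, Y⟩ := t
  obtain ⟨h1, h2⟩ := (ite_ne_right_iff.1 h).1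
  have hq : Saturated q (X ∪ Y) := h1.saturated_right.union h2.1
  refine ⟨h1.mono (fun e f hef => ?_) Set.subset_union_left,
    h2.mono hq Set.subset_union_right⟩
  by_cases he : e ∈ X
  · exact iff_of_true (Or.inl he) (Or.inl ((h1.1 e f hef).1 he))
  · exact hq e f ((h1.2 e he f).1 hef)

theorem SimpleOff.trans {p q r : Setoid E} {Z : Set E} (h : SimpleOff ⟨p, q⟩ Z)
    (h' : SimpleOff ⟨q, r⟩ Z) : SimpleOff ⟨p, r⟩ Z :=
  ⟨h.1, fun e he f => (h.2 e he f).trans (h'.2 e he f)⟩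

theorem SimpleOff.symm {p q : Setoid E} {Z : Set E} (h : SimpleOff ⟨p, q⟩ Z) :
    SimpleOff ⟨q, p⟩ Z :=
  ⟨h.saturated_right, fun e he f => (h.2 e he f).symm⟩

/-- The partition that agrees with `q` on `D` and with `p` off `D`. -/
def extendSetoid (p : Setoid E) (i : D → E) (hi : Function.Injective i)
    (hp : Saturated p (Set.range i)) (q : Setoid D) : Setoid E where
  r e f := (∃ d d', i d = e ∧ i d' = f ∧ q d d') ∨ (e ∉ Set.range i ∧ p e f)
  iseqv :=
    { refl := fun e => by
        by_cases he : e ∈ Set.range i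
        · obtain ⟨d, rfl⟩ := he
          exact Or.inl ⟨d, d, rfl, rfl, q.refl d⟩
        · exact Or.inr ⟨he, p.refl e⟩
      symm := by
        rintro e f (⟨d, d', rfl, rfl, h⟩ | ⟨he, h⟩)
        · exact Or.inl ⟨d', d, rfl, rfl, q.symm h⟩
        · exact Or.inr ⟨fun hf => he ((hp e f h).2 hf), p.symm h⟩
      trans := by
        rintro e f g (⟨d, d', rfl, rfl, h⟩ | ⟨he, h⟩) (⟨c, c', hc, rfl, h'⟩ | ⟨hf, h'⟩)
        · rw [hi hc] at h'
          exact Or.inl ⟨d, c', rfl, rfl, q.trans h h'⟩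
        · exact absurd ⟨d', rfl⟩ hf
        · exact absurd ((hp e f h).2 ⟨c, hc⟩) he
        · exact Or.inr ⟨he, p.trans h h'⟩ }

theorem extendSetoid_comap (p : Setoid E) (i : D → E) (hi : Function.Injective i)
    (hp : Saturated p (Set.range i)) (q : Setoid D) :
    (extendSetoid p i hi hp q).comap i = q := by
  ext x y
  rw [Setoid.comap_rel]
  constructor
  · rintro (⟨d, d', hd, hd', h⟩ | ⟨he, h⟩)
    · rwa [← hi hd, ← hi hd']
    · exact absurd ⟨x, rfl⟩ he
  · exact fun h => Or.inl ⟨x, y, rfl, rfl, h⟩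

theorem extendSetoid_simpleOff (p : Setoid E) (i : D → E) (hi : Function.Injective i)
    (hp : Saturated p (Set.range i)) (q : Setoid D) :
    SimpleOff ⟨p, extendSetoid p i hi hp q⟩ (Set.range i) := by
  refine ⟨hp, fun e he f => ⟨fun h => Or.inr ⟨he, h⟩, ?_⟩⟩
  rintro (⟨d, d', rfl, rfl, h⟩ | ⟨he, h⟩)
  · exact absurd ⟨d, rfl⟩ he
  · exact h

theorem weight_comap [Finite E] [Finite D] (f g : (Σ n, BipClass n) → ℂ) (Γ : BipGraph E)
    {i : D → E} (hi : Function.Injective i) {q : Setoid E} {X Y : Set E}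
    (h1 : SimpleOff ⟨Γ.left, q⟩ (Set.range i)) (h2 : SimpleOff ⟨q, Γ.right⟩ (Set.range i))
    (hX : X ⊆ Set.range i) (hY : Y ⊆ Set.range i) :
    weight f g (Γ.comap i) (q.comap i, i ⁻¹' X, i ⁻¹' Y) = weight f g Γ (q, X, Y) := by
  have e1 := simpleOff_comap_iff h1 hX
  have e2 := simpleOff_comap_iff h2 hY
  have e3 := cls_induce_comap ⟨Γ.left, q⟩ hi hX
  have e4 := cls_induce_comap ⟨q, Γ.right⟩ hi hY
  simp only [comap] at e1 e2 e3 e4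
  simp only [weight, comap, e1, e2, e3, e4]

/-- The contributions of the pairs of sets with a given union are those on the subgraph. -/
theorem sum_weight_eq_coverSum [Finite E] [Finite D] (f g : (Σ n, BipClass n) → ℂ)
    (Γ : BipGraph E) {i : D → E} (hi : Function.Injective i) (hΓ : Γ.SimpleOff (Set.range i)) :
    ∑ t : Setoid E × Set E × Set E with t.2.1 ∪ t.2.2 = Set.range i, weight f g Γ t =
      coverSum f g (Γ.comap i) := by
  -- In nonzero terms `q` agrees with `Γ.left` off the range, so restriction to `D` loses nothing;
  -- `extendSetoid` supplies the inverse.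
  rw [← Finset.sum_filter_of_ne (p := fun t => SimpleOff ⟨Γ.left, t.1⟩ (Set.range i))
    (fun t ht h => by
      rw [← (Finset.mem_filter.1 ht).2]
      exact (simpleOff_of_weight_ne_zero h).1), coverSum]
  refine Finset.sum_bij (fun t _ => (t.1.comap i, i ⁻¹' t.2.1, i ⁻¹' t.2.2)) ?_ ?_ ?_ ?_
  · rintro ⟨q, X, Y⟩ ht
    simp only [Finset.mem_filter, Finset.mem_univ, true_and] at ht ⊢
    rw [← Set.preimage_union, ht.1, Set.preimage_range]
  · rintro ⟨q, X, Y⟩ ht ⟨q', X', Y'⟩ ht' h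
    simp only [Finset.mem_filter, Finset.mem_univ, true_and] at ht ht'
    simp only [Prod.mk.injEq] at h
    have hset : ∀ {U V : Set E}, U ⊆ Set.range i → V ⊆ Set.range i →
        i ⁻¹' U = i ⁻¹' V → U = V := by
      intro U V hU hV h
      rw [← Set.image_preimage_eq_of_subset hU, h, Set.image_preimage_eq_of_subset hV]
    obtain rfl : X = X' := hset (ht.1 ▸ Set.subset_union_left)
      (ht'.1 ▸ Set.subset_union_left) h.2.1
    obtain rfl : Y = Y' := hset (ht.1 ▸ Set.subset_union_right)
      (ht'.1 ▸ Set.subset_union_right) h.2.2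
    obtain rfl : q = q' := by
      ext e f
      by_cases he : e ∈ Set.range i
      · by_cases hf : f ∈ Set.range i
        · obtain ⟨e, rfl⟩ := he
          obtain ⟨f, rfl⟩ := hf
          exact Setoid.ext_iff.1 h.1 e f
        · exact iff_of_false (fun h' => hf ((ht.2.saturated_right e f h').1 he))
            fun h' => hf ((ht'.2.saturated_right e f h').1 he)
      · exact (ht.2.2 e he f).symm.trans (ht'.2.2 e he f)
    rfl
  · rintro ⟨q, X, Y⟩ ht
    simp only [Finset.mem_filter, Finset.mem_univ, true_and] at ht
    refine ⟨(extendSetoid Γ.left i hi hΓ.1 q, i '' X, i '' Y), ?_, ?_⟩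
    · simp only [Finset.mem_filter, Finset.mem_univ, true_and]
      exact ⟨by rw [← Set.image_union, ht, Set.image_univ], extendSetoid_simpleOff _ _ hi hΓ.1 q⟩
    · simp only [extendSetoid_comap, Set.preimage_image_eq _ hi]
  · rintro ⟨q, X, Y⟩ ht
    simp only [Finset.mem_filter, Finset.mem_univ, true_and] at ht
    exact (weight_comap f g Γ hi ht.2 (ht.2.symm.trans hΓ) (ht.1 ▸ Set.subset_union_left)
      (ht.1 ▸ Set.subset_union_right)).symm

theorem coverSum_comap [Finite E] [Finite D] (f g : (Σ n, BipClass n) → ℂ) (Γ : BipGraph E)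
    (a : D ≃ E) : coverSum f g (Γ.comap a) = coverSum f g Γ := by
  have hr : Set.range a = Set.univ := a.surjective.range_eq
  rw [← sum_weight_eq_coverSum f g Γ a.injective (by rw [hr]; exact simpleOff_univ Γ), hr,
    coverSum]

/-- The sum of the contributions of the covering pairs of sets as a function of the isomorphism
class. -/
def coverClass (f g : (Σ n, BipClass n) → ℂ) (n : ℕ) : BipClass n → ℂ :=
  Quotient.lift (coverSum f g) fun Γ Δ ⟨a, h⟩ => by
    rw [isIso_iff.1 h, coverSum_comap]

theorem coverClass_cls [Finite E] (f g : (Σ n, BipClass n) → ℂ) (Γ : BipGraph E) :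
    coverClass f g (cls Γ).1 (cls Γ).2 = coverSum f g Γ :=
  coverSum_comap f g Γ (Finite.equivFin E).symm

/-- The covering sum of two graphs vanishes outside of the expected range of degrees. -/
theorem coverSum_single_eq_zero [Finite E] (c d : Σ n, BipClass n) (Γ : BipGraph E)
    (h : Nat.card E < max c.1 d.1 ∨ c.1 + d.1 < Nat.card E) :
    coverSum (Finsupp.single c (1 : ℂ)) (Finsupp.single d (1 : ℂ)) Γ = 0 := by
  refine Finset.sum_eq_zero ?_
  rintro ⟨q, X, Y⟩ ht
  have hXY : X ∪ Y = Set.univ := (Finset.mem_filter.1 ht).2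
  rw [weight]
  refine ite_eq_right_iff.2 fun _ => ?_
  by_contra hne
  have h1 := left_ne_zero_of_mul hne
  have h2 := right_ne_zero_of_mul hne
  -- A nonzero term has `|X| = c.1`, `|Y| = d.1` and `X ∪ Y` everything, so the number of edges lies
  -- between the maximum and the sum.
  rw [Finsupp.single_apply, ite_ne_right_iff] at h1 h2
  have hX : c.1 = X.ncard := congrArg Sigma.fst h1.1
  have hY : d.1 = Y.ncard := congrArg Sigma.fst h2.1
  have h3 := Set.ncard_union_le X Y
  have h4 : X.ncard ≤ Nat.card E := Set.ncard_le_card X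
  have h5 : Y.ncard ≤ Nat.card E := Set.ncard_le_card Y
  rw [hXY, Set.ncard_univ] at h3
  omega

end BipGraph

/-! ### The recursion, multiplicativity and associativity -/

theorem mul_rhoTot_apply (n : ℕ) (x y : BInf) (Γ : BipGraph (Fin n)) :
    mul n (rhoTot n x) (rhoTot n y) (BipClass.mk Γ) =
      ∑ Z : Set (Fin n), if Γ.SimpleOff Z then coverSum x y (Γ.induce Z) else 0 := by
  have h1 : mul n (rhoTot n x) (rhoTot n y) (BipClass.mk Γ) =
      ∑ t : Setoid (Fin n) × Set (Fin n) × Set (Fin n), weight x y Γ t := by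
    have hu : (univ : Finset (Setoid (Fin n) × Set (Fin n) × Set (Fin n))) =
      univ ×ˢ (univ ×ˢ univ) := by ext; simp
    rw [hu, Finset.sum_product]
    obtain ⟨p, r⟩ := Γ
    rw [mul_apply]
    refine Finset.sum_congr rfl fun q _ => ?_
    rw [Finset.sum_product, rhoTot_apply, rhoTot_apply, Finset.sum_mul_sum]
    refine Finset.sum_congr rfl fun X _ => Finset.sum_congr rfl fun Y _ => ?_
    rw [weight, ite_and]
    split_ifs <;> simp
  -- Triples are grouped by `Z = X ∪ Y`; if `Γ` is not simple off `Z`, every weight in the group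
  -- vanishes.
  rw [h1, ← Finset.sum_fiberwise (g := fun t : Setoid (Fin n) × Set (Fin n) × Set (Fin n) =>
    t.2.1 ∪ t.2.2)]
  refine Finset.sum_congr rfl fun Z _ => ?_
  split_ifs with hZ
  · have := sum_weight_eq_coverSum x y Γ (i := (Subtype.val : Z → Fin n))
      Subtype.val_injective (by rwa [Subtype.range_coe])
    rw [Subtype.range_coe] at this
    exact this
  · refine Finset.sum_eq_zero fun t ht => ?_
    by_contra hne
    obtain ⟨h1, h2⟩ := simpleOff_of_weight_ne_zero hne
    rw [(Finset.mem_filter.1 ht).2] at h1 h2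
    exact hZ (h1.trans h2)

/-- The component of degree `n` of the product of two graphs: the number of ways of
decomposing the graph into overlapping extensions that cover all edges. -/
def component {m₁ m₂ : ℕ} (Γ₁ : BipClass m₁) (Γ₂ : BipClass m₂) (n : ℕ) : B n :=
  Finsupp.equivFunOnFinite.symm
    (coverClass (Finsupp.single ⟨m₁, Γ₁⟩ (1 : ℂ)) (Finsupp.single ⟨m₂, Γ₂⟩ (1 : ℂ)) n)

theorem component_eq_zero {m₁ m₂ : ℕ} (Γ₁ : BipClass m₁) (Γ₂ : BipClass m₂) {n : ℕ}
    (h : n < max m₁ m₂ ∨ m₁ + m₂ < n) : component Γ₁ Γ₂ n = 0 := by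
  ext c
  induction c using Quotient.inductionOn with
  | h Γ => exact coverSum_single_eq_zero ⟨m₁, Γ₁⟩ ⟨m₂, Γ₂⟩ Γ (by simpa using h)

theorem incl_apply (k : ℕ) (x : B k) (c : Σ n, BipClass n) :
    incl k x c = if h : k = c.1 then x (h ▸ c.2) else 0 := by
  split_ifs with h
  · obtain ⟨n, c⟩ := c
    obtain rfl : k = n := h
    exact Finsupp.mapDomain_apply sigma_mk_injective x _
  · refine Finsupp.mapDomain_of_notMem_range _ _ ?_
    rintro ⟨d, rfl⟩
    exact h rfl

theorem starMul_eq_mul_rhoTot {m₁ m₂ : ℕ} (Γ₁ : BipClass m₁) (Γ₂ : BipClass m₂) (n : ℕ) :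
    starMul Γ₁ Γ₂ n = mul n (rhoTot n (Finsupp.single ⟨m₁, Γ₁⟩ 1))
      (rhoTot n (Finsupp.single ⟨m₂, Γ₂⟩ 1)) := by
  rw [rhoTot_single, rhoTot_single, one_smul, one_smul, starMul]

/-- Both sides are sums over `Z` of the covering sum on `Γ|Z`; on the right, `k` is the number of
edges of `Z`. -/
theorem starMul_eq_sum {m₁ m₂ : ℕ} (Γ₁ : BipClass m₁) (Γ₂ : BipClass m₂) (n : ℕ) :
    starMul Γ₁ Γ₂ n = ∑ k ∈ range (n + 1), rho k n (component Γ₁ Γ₂ k) := by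
  ext c
  induction c using Quotient.inductionOn with
  | h Γ =>
  change starMul Γ₁ Γ₂ n (BipClass.mk Γ) =
    (∑ k ∈ range (n + 1), rho k n (component Γ₁ Γ₂ k)) (BipClass.mk Γ)
  simp only [← rhoTot_incl]
  rw [← map_sum, rhoTot_apply, starMul_eq_mul_rhoTot, mul_rhoTot_apply]
  refine Finset.sum_congr rfl fun Z _ => if_congr Iff.rfl ?_ rfl
  have hZ : (cls (Γ.induce Z)).1 ∈ range (n + 1) := by
    have : Nat.card Z ≤ Nat.card (Fin n) := Finite.card_subtype_le _
    rw [Nat.card_fin] at this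
    exact Finset.mem_range.2 (Nat.lt_succ_of_le this)
  rw [Finsupp.finsetSum_apply, Finset.sum_eq_single_of_mem _ hZ fun k _ hk => by
    rw [incl_apply, dif_neg hk], incl_apply, dif_pos rfl]
  exact (coverClass_cls _ _ _).symm

/-- In `starMul_eq_sum` the top term is the component itself, because `rho n n` is the identity;
solving for it gives the recursion. -/
theorem bracket_eq_component {m₁ m₂ : ℕ} (Γ₁ : BipClass m₁) (Γ₂ : BipClass m₂) (n : ℕ) :
    bracket Γ₁ Γ₂ n = component Γ₁ Γ₂ n := by
  induction n using Nat.strong_induction_on with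
  | _ n ih =>
  rw [bracket]
  split_ifs with h
  · exact (component_eq_zero Γ₁ Γ₂ (Or.inl h)).symm
  · rw [Finset.sum_attach (Ico (max m₁ m₂) n) (fun k => rho k n (bracket Γ₁ Γ₂ k)),
      Finset.sum_congr rfl fun k hk => by rw [ih k (Finset.mem_Ico.1 hk).2], starMul_eq_sum,
      Finset.sum_range_succ, rho_self]
    have : ∑ k ∈ Ico (max m₁ m₂) n, rho k n (component Γ₁ Γ₂ k) =
        ∑ k ∈ range n, rho k n (component Γ₁ Γ₂ k) := by
      refine Finset.sum_subset (fun k hk => ?_) fun k hk hk' => ?_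
      · exact Finset.mem_range.2 (Finset.mem_Ico.1 hk).2
      · have hlt : k < max m₁ m₂ := by
          by_contra hle
          exact hk' (Finset.mem_Ico.2 ⟨not_lt.1 hle, Finset.mem_range.1 hk⟩)
        rw [component_eq_zero Γ₁ Γ₂ (Or.inl hlt), map_zero]
    rw [this, add_sub_cancel_left]

theorem bracket_eq_zero {m₁ m₂ : ℕ} (Γ₁ : BipClass m₁) (Γ₂ : BipClass m₂) {n : ℕ}
    (h : m₁ + m₂ < n) : bracket Γ₁ Γ₂ n = 0 := by
  rw [bracket_eq_component, component_eq_zero Γ₁ Γ₂ (Or.inr h)]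

theorem classCirc_eq_sum {m₁ m₂ : ℕ} (Γ₁ : BipClass m₁) (Γ₂ : BipClass m₂) :
    classCirc Γ₁ Γ₂ = ∑ k ∈ range (m₁ + m₂ + 1), incl k (component Γ₁ Γ₂ k) := by
  have h : ∀ k, (∑ᶠ (_ : max m₁ m₂ ≤ k), incl k (bracket Γ₁ Γ₂ k)) =
      incl k (component Γ₁ Γ₂ k) := by
    intro k
    rw [bracket_eq_component]
    by_cases hk : max m₁ m₂ ≤ k
    · rw [finsum_eq_if, if_pos hk]
    · rw [finsum_eq_if, if_neg hk, component_eq_zero Γ₁ Γ₂ (Or.inl (not_le.1 hk)), map_zero]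
  -- Finite support matters here: otherwise `finsum` would take its default value zero.
  rw [classCirc, finsum_congr h, finsum_eq_sum_of_support_subset]
  intro k hk
  rw [Finset.coe_range, Set.mem_Iio]
  by_contra hlt
  refine hk ?_
  dsimp only
  rw [component_eq_zero Γ₁ Γ₂ (Or.inr (by omega)), map_zero]

theorem rho_of_lt {k n : ℕ} (h : n < k) : rho k n = 0 := dif_neg (not_le.2 h)

theorem rhoTot_classCirc {m₁ m₂ : ℕ} (Γ₁ : BipClass m₁) (Γ₂ : BipClass m₂) (n : ℕ) :
    rhoTot n (classCirc Γ₁ Γ₂) = starMul Γ₁ Γ₂ n := by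
  rw [classCirc_eq_sum, map_sum, starMul_eq_sum]
  simp only [rhoTot_incl]
  -- In this common range the extra terms vanish: components above `m₁ + m₂` are zero, and so is
  -- `rho k n` for `k > n`.
  trans ∑ k ∈ range (max (m₁ + m₂ + 1) (n + 1)), rho k n (component Γ₁ Γ₂ k)
  · refine Finset.sum_subset (Finset.range_mono (le_max_left _ _)) fun k _ hk => ?_
    rw [Finset.mem_range] at hk
    rw [component_eq_zero Γ₁ Γ₂ (Or.inr (by omega)), map_zero]
  · refine (Finset.sum_subset (Finset.range_mono (le_max_right _ _)) fun k _ hk => ?_).symm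
    rw [Finset.mem_range] at hk
    rw [rho_of_lt (by omega), LinearMap.zero_apply]

theorem rhoTot_circ (n : ℕ) (x y : BInf) :
    rhoTot n (circ x y) = mul n (rhoTot n x) (rhoTot n y) := by
  induction x using Finsupp.induction_linear with
  | zero => simp
  | add x x' hx hx' => simp [hx, hx']
  | single c z =>
    induction y using Finsupp.induction_linear with
    | zero => simp
    | add y y' hy hy' => simp [hy, hy']
    | single d w =>
      have : circ (Finsupp.single c z) (Finsupp.single d w) = z • w • classCirc c.2 d.2 := by
        simp [circ]
      rw [this, map_smul, map_smul, rhoTot_classCirc, rhoTot_single, rhoTot_single, starMul]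
      simp [smul_comm z w]

theorem circ_assoc (a b c : BInf) : circ (circ a b) c = circ a (circ b c) := by
  refine sub_eq_zero.1 (eq_zero_of_rhoTot fun n => ?_)
  rw [map_sub, rhoTot_circ, rhoTot_circ, rhoTot_circ, rhoTot_circ, mul_mul, sub_self]

end BipartiteGraphs

end

theorem lemma3 :
    (∀ a b c : BipartiteGraphs.BInf,
      BipartiteGraphs.circ (BipartiteGraphs.circ a b) c =
        BipartiteGraphs.circ a (BipartiteGraphs.circ b c)) ∧
    (∀ (m₁ m₂ : ℕ) (Γ₁ : BipartiteGraphs.BipClass m₁) (Γ₂ : BipartiteGraphs.BipClass m₂) (n : ℕ),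
      m₁ + m₂ < n → BipartiteGraphs.bracket Γ₁ Γ₂ n = 0) :=
  ⟨BipartiteGraphs.circ_assoc, fun _ _ Γ₁ Γ₂ _ h => BipartiteGraphs.bracket_eq_zero Γ₁ Γ₂ h⟩
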